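/- Let $f_1,\dots,f_n:\mathbb R^d\to\mathbb R\cup\{+\infty\}$ be $\mu$-strongly convex for some $\mu>0$ (that is, $f_i-\frac\mu2\|\cdot\|^2$ is convex), let $\bigcap_i \operatorname{dom} f_i$ have nonempty interior, and put $L=1/\mu$. Consider minimizing $F(\mathbf x)=\sum_i f_i(x_i)$ over $\mathbf x=(x_1,\dots,x_n)\in\mathbb R^{nd}$ with $x_1=\dots=x_n$, with optimal value $F^\star$ and optimal solution $\mathbf x^\star$, and the dual problem of minimizing $D(\mathbf w)=\sum_i d_i(w_i)$ subject to $\sum_i w_i=0$, where $d_i(w)=\sup_x\{\langle w,x\rangle-f_i(x)\}$, with optimal value $D^\star$. Let $\mathcal G^k=(\mathcal V,\mathcal E^k)$, $k\ge0$, be undirected graphs on $\mathcal V=\{1,\dots,n\}$, with neighbor sets $\mathcal N_i^k$, and let $B\ge1$ be an integer such that the union graph $\tilde{\mathcal G}^k=(\mathcal V,\bigcup_{t=k}^{k+B-1}\mathcal E^t)$ is connected for every $k\ge0$. Let $h_{ij}^k=h_{ji}^k$ for $\{i,j\}\in\mathcal E^k$ be weights with $\underline h=\inf_{k}\inf_{\{i,j\}\in\mathcal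 E^k}h_{ij}^k>0$ and $\sum_{j\in\mathcal N_i^k}h_{ij}^k\le1$ for all $i,k$. Let $\beta\in(0,1/L)$, $c_1,c_2>0$, and let $m\ge1$ be an integer. Let $(\mathbf w^k)_{k\ge0}$, $(\mathbf x^k)_{k\ge0}$ be generated by FDGM-AA (the Fenchel dual gradient method with Anderson acceleration and safe-guard): $\sum_i w_i^0=0$ and, for every $k\ge0$ and every node $i$, $x_i^k\in\arg\max_x\{\langle w_i^k,x\rangle-f_i(x)\}$ (so that $\nabla d_i(w_i^k)=x_i^k$) and $$w_i^{k+1}=\Bigl(1-\sum_{j\in\mathcal N_i^k}h_{ij}^k\Bigr)w_i^k+\sum_{j\in\mathcal N_i^k}h_{ij}^k\,w_{ij}^{k+\frac12}.$$ Here, for each edge $\{i,j\}\in\mathcal E^k$, $\mathcal I=\mathcal I_{ij}^k$ is the set of the $m$ most recent times $t\le k$ with $\{i,j\}\in\mathcal E^t$ (all such times if there are fewer than $m$); $(\alpha_{ij},\alpha_{ji})\in\mathbb R^{\mathcal I}\times\mathbb R^{\mathcal I}$ is any minimizer of $\bigl\|\sum_{t\in\mathcal I}\alpha_{ij}^t\nabla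 d_i(w_i^t)-\sum_{t\in\mathcal I}\alpha_{ji}^t\nabla d_j(w_j^t)\bigr\|^2$ subject to $\sum_{t\in\mathcal I}\alpha_{ij}^tw_i^t+\sum_{t\in\mathcal I}\alpha_{ji}^tw_j^t=w_i^k+w_j^k$ and $\sum_{t\in\mathcal I}\alpha_{ij}^t=\sum_{t\in\mathcal I}\alpha_{ji}^t=1$; $$\bar w_{ij}=\sum_{t\in\mathcal I}\alpha_{ij}^tw_i^t-\beta\Bigl(\sum_{t\in\mathcal I}\alpha_{ij}^t\nabla d_i(w_i^t)-\sum_{t\in\mathcal I}\alpha_{ji}^t\nabla d_j(w_j^t)\Bigr),$$ and $\bar w_{ji}$ is given by the same formula with $i$ and $j$ exchanged. If the safe-guard condition $$\langle\nabla d_i(w_i^k),\bar w_{ij}-w_i^k\rangle+\tfrac L2\|\bar w_{ij}-w_i^k\|^2+\langle\nabla d_j(w_j^k),\bar w_{ji}-w_j^k\rangle+\tfrac L2\|\bar w_{ji}-w_j^k\|^2$$ $$\le\min\bigl\{-c_1\|\nabla d_i(w_i^k)-\nabla d_j(w_j^k)\|^2,\,-c_2\bigl(\|\bar w_{ij}-w_i^k\|^2+\|\bar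 w_{ji}-w_j^k\|^2\bigr)\bigr\}$$ holds, then $(w_{ij}^{k+\frac12},w_{ji}^{k+\frac12})=(\bar w_{ij},\bar w_{ji})$; otherwise $w_{ij}^{k+\frac12}=w_i^k-\beta(\nabla d_i(w_i^k)-\nabla d_j(w_j^k))$ and $w_{ji}^{k+\frac12}=w_j^k-\beta(\nabla d_j(w_j^k)-\nabla d_i(w_i^k))$. Put $\theta_1=\min\{\beta(1-\beta L),c_1\}$, $\theta_2=\min\{(1/\beta-L)/2,c_2\}$; let $\tilde\eta$ be the maximum over $t\ge0$ of the maximum degree of $\tilde{\mathcal G}^{tB}$, let $\underline\lambda$ be the infimum over $t\ge0$ of the smallest nonzero eigenvalue of the graph Laplacian of $\tilde{\mathcal G}^{tB}$, and let $$\tau=\frac{3BL^2\tilde\eta}{\theta_2}+\frac{3}{\underline h\,\theta_1}.$$ Then the $d_i$ are finite, $D^\star$ is attained, $F^\star$ and all $F(\mathbf x^k)$ are finite, and $S_0=\{\mathbf w: D(\mathbf w)\le D(\mathbf w^0),\ \sum_iw_i=0\}$ is compact; let $R_0$ be its diameter. For all $k\ge0$, $$D(\mathbf w^k)-D^\star\le\frac{\tau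 R_0^2\,(D(\mathbf w^0)-D^\star)}{\tau R_0^2+\underline\lambda\lfloor k/B\rfloor(D(\mathbf w^0)-D^\star)},$$ $$\|\mathbf x^k-\mathbf x^\star\|\le\sqrt{2L(D(\mathbf w^k)-D^\star)},\qquad |F(\mathbf x^k)-F^\star|\le(R_0+\|\mathbf w^0\|)\sqrt{2L(D(\mathbf w^k)-D^\star)},$$ so that the dual error is $O(1/k)$ and the two primal errors are $O(1/\sqrt k)$ as $k\to\infty$. The bound on $\|\mathbf x^k-\mathbf x^\star\|$ holds for any optimal solution $\mathbf x^\star$; one exists and is unique whenever the suprema defining the $d_i$ are attained at every $w$ (for instance, for lower semicontinuous $f_i$). When the quotient in the first bound has zero denominator, it is read as $0$. -/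

import Mathlib

open scoped InnerProductSpace Asymptotics

noncomputable section

namespace FDGMAA

/-- The decision space `ℝ^d` of one node. -/
abbrev Vec (d : ℕ) := EuclideanSpace ℝ (Fin d)

/-- Stacked vectors `(v₁, …, vₙ) ∈ ℝ^{nd}` with the Euclidean norm. -/
abbrev Stack (n d : ℕ) := PiLp 2 (fun _ : Fin n => Vec d)

/-! ### Objective, conjugates, primal and dual problem -/

/-- Effective domain of an extended-real-valued function. -/
def dom {d : ℕ} (f : Vec d → EReal) : Set (Vec d) := {x | f x ≠ ⊤}

/-- `x` attains `max_y ⟪w, y⟫ - f y`. -/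
def IsConjMaximizer {d : ℕ} (f : Vec d → EReal) (w x : Vec d) : Prop :=
  ∀ y : Vec d, ((⟪w, y⟫_ℝ : ℝ) : EReal) - f y ≤ ((⟪w, x⟫_ℝ : ℝ) : EReal) - f x

/-- The convex conjugate of `f`, with values in the extended reals. -/
def conj {d : ℕ} (f : Vec d → EReal) (w : Vec d) : EReal :=
  ⨆ y : Vec d, ((⟪w, y⟫_ℝ : ℝ) : EReal) - f y

/-- The convex conjugate as a real function (it is finite for the functions considered here). -/
def dual {d : ℕ} (f : Vec d → EReal) (w : Vec d) : ℝ := (conj f w).toReal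

variable {n d : ℕ}

/-- Total objective `F(x) = ∑ i, f_i(x_i)`. -/
def primalObj (f : Fin n → Vec d → EReal) (x : Stack n d) : EReal := ∑ i, f i (x i)

/-- The consensus set `x₁ = … = xₙ`. -/
def consensus (n d : ℕ) : Set (Stack n d) := {x | ∀ i j, x i = x j}

/-- Optimal value `F⋆` of the consensus problem. -/
def primalValue (f : Fin n → Vec d → EReal) : EReal := ⨅ x ∈ consensus n d, primalObj f x

/-- `x` is an optimal solution of the consensus problem. -/
def IsPrimalSolution (f : Fin n → Vec d → EReal) (x : Stack n d) : Prop :=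
  x ∈ consensus n d ∧ ∀ y ∈ consensus n d, primalObj f x ≤ primalObj f y

/-- Dual objective `D(w) = ∑ i, d_i(w_i)`. -/
def dualObj (f : Fin n → Vec d → EReal) (w : Stack n d) : ℝ := ∑ i, dual (f i) (w i)

/-- Dual feasible set `w₁ + … + wₙ = 0`. -/
def dualFeasible (n d : ℕ) : Set (Stack n d) := {w | ∑ i, w i = 0}

/-- Optimal value `D⋆` of the dual problem. -/
def dualValue (f : Fin n → Vec d → EReal) : ℝ := sInf (dualObj f '' dualFeasible n d)

/-- The initial sublevel set `S₀`. -/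
def sublevel (f : Fin n → Vec d → EReal) (w0 : Stack n d) : Set (Stack n d) :=
  {w | dualObj f w ≤ dualObj f w0 ∧ w ∈ dualFeasible n d}

/-- `R₀`, the largest distance between two points of `S₀`. -/
def radius (f : Fin n → Vec d → EReal) (w0 : Stack n d) : ℝ := Metric.diam (sublevel f w0)

/-! ### The algorithm -/

open Classical in
/-- Neighbours of node `i` in the graph `G`. -/
def nbrs (G : SimpleGraph (Fin n)) (i : Fin n) : Finset (Fin n) :=
  Finset.univ.filter fun j => G.Adj i j

open Classical in
/-- The `m` most recent iterations `t ≤ k` at which `i` and `j` communicate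
(all of them if there are fewer than `m`): those followed, up to time `k`, by fewer than `m`
further ones. -/
def history (G : ℕ → SimpleGraph (Fin n)) (m k : ℕ) (i j : Fin n) : Finset ℕ :=
  (Finset.range (k + 1)).filter fun t =>
    (G t).Adj i j ∧
      ((Finset.range (k + 1)).filter fun s => t < s ∧ (G s).Adj i j).card < m

/-- `∇ d_i(w_i^k)`. -/
def dualGrad (f : Fin n → Vec d → EReal) (w : ℕ → Stack n d) (k : ℕ) (i : Fin n) : Vec d :=
  gradient (dual (f i)) (w k i)

/-- The combination `∑ t ∈ I, a_t w_i^t` of past dual iterates of node `i`. -/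
def combIter (w : ℕ → Stack n d) (I : Finset ℕ) (i : Fin n) (a : ℕ → ℝ) : Vec d :=
  ∑ t ∈ I, a t • w t i

/-- The combination `∑ t ∈ I, a_t ∇ d_i(w_i^t)` of past dual gradients of node `i`. -/
def combGrad (f : Fin n → Vec d → EReal) (w : ℕ → Stack n d) (I : Finset ℕ) (i : Fin n)
    (a : ℕ → ℝ) : Vec d :=
  ∑ t ∈ I, a t • dualGrad f w t i

/-- Constraints of the coefficient problem of the edge `{i, j}` at time `k`. -/
def CoeffFeasible (w : ℕ → Stack n d) (I : Finset ℕ) (k : ℕ) (i j : Fin n)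
    (a b : ℕ → ℝ) : Prop :=
  combIter w I i a + combIter w I j b = w k i + w k j ∧ ∑ t ∈ I, a t = 1 ∧ ∑ t ∈ I, b t = 1

/-- `(a, b)` solves the coefficient problem of the edge `{i, j}` at time `k`.  Coefficients are
indexed by all times, but only those in `I` matter. -/
def CoeffOptimal (f : Fin n → Vec d → EReal) (w : ℕ → Stack n d) (I : Finset ℕ) (k : ℕ)
    (i j : Fin n) (a b : ℕ → ℝ) : Prop :=
  CoeffFeasible w I k i j a b ∧
    ∀ a' b' : ℕ → ℝ, CoeffFeasible w I k i j a' b' →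
      ‖combGrad f w I i a - combGrad f w I j b‖ ^ 2 ≤
        ‖combGrad f w I i a' - combGrad f w I j b'‖ ^ 2

/-- The Anderson candidate `w̄_{ij}` of node `i` for its neighbour `j`, from the coefficients
`a` of `i` and `b` of `j`. -/
def candidate (f : Fin n → Vec d → EReal) (w : ℕ → Stack n d) (β : ℝ) (I : Finset ℕ)
    (i j : Fin n) (a b : ℕ → ℝ) : Vec d :=
  combIter w I i a - β • (combGrad f w I i a - combGrad f w I j b)

/-- The plain step `w_i^k - β (∇ d_i(w_i^k) - ∇ d_j(w_j^k))`. -/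
def plainStep (f : Fin n → Vec d → EReal) (w : ℕ → Stack n d) (β : ℝ) (k : ℕ)
    (i j : Fin n) : Vec d :=
  w k i - β • (dualGrad f w k i - dualGrad f w k j)

/-- The safe-guard condition for the candidate pair `(u, v)` of the edge `{i, j}`. -/
def SafeGuard (f : Fin n → Vec d → EReal) (w : ℕ → Stack n d) (L c₁ c₂ : ℝ) (k : ℕ)
    (i j : Fin n) (u v : Vec d) : Prop :=
  ⟪dualGrad f w k i, u - w k i⟫_ℝ + L / 2 * ‖u - w k i‖ ^ 2
      + ⟪dualGrad f w k j, v - w k j⟫_ℝ + L / 2 * ‖v - w k j‖ ^ 2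
    ≤ min (-c₁ * ‖dualGrad f w k i - dualGrad f w k j‖ ^ 2)
        (-c₂ * (‖u - w k i‖ ^ 2 + ‖v - w k j‖ ^ 2))

open Classical in
/-- The intermediate point `w_{ij}^{k+1/2}`, given the coefficients `a` of `i` and `b` of `j`. -/
def halfStep (f : Fin n → Vec d → EReal) (w : ℕ → Stack n d) (β L c₁ c₂ : ℝ)
    (I : Finset ℕ) (k : ℕ) (i j : Fin n) (a b : ℕ → ℝ) : Vec d :=
  if SafeGuard f w L c₁ c₂ k i j (candidate f w β I i j a b) (candidate f w β I j i b a) then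
    candidate f w β I i j a b
  else plainStep f w β k i j

/-- `(w^k)` and `(x^k)` are generated by FDGM-AA on the graphs `G k` with edge weights `h k`,
step-size `β`, smoothness constant `L`, safe-guard constants `c₁, c₂` and memory `m`.
The coefficients `α k i j` of an edge are any solution of its coefficient problem. -/
structure IsRun (f : Fin n → Vec d → EReal) (G : ℕ → SimpleGraph (Fin n))
    (h : ℕ → Fin n → Fin n → ℝ) (β L c₁ c₂ : ℝ) (m : ℕ) (w x : ℕ → Stack n d) : Prop where
  init : ∑ i, w 0 i = 0
  primal : ∀ k i, IsConjMaximizer (f i) (w k i) (x k i)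
  step : ∃ α : ℕ → Fin n → Fin n → ℕ → ℝ,
    (∀ k i j, (G k).Adj i j →
      CoeffOptimal f w (history G m k i j) k i j (α k i j) (α k j i)) ∧
    ∀ k i, w (k + 1) i =
      (1 - ∑ j ∈ nbrs (G k) i, h k i j) • w k i +
        ∑ j ∈ nbrs (G k) i, h k i j •
          halfStep f w β L c₁ c₂ (history G m k i j) k i j (α k i j) (α k j i)

/-! ### Networks and constants -/

/-- The union graph over the times `k, …, k + B - 1`. -/
def unionGraph (G : ℕ → SimpleGraph (Fin n)) (B k : ℕ) : SimpleGraph (Fin n) :=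
  ⨆ t ∈ Set.Ico k (k + B), G t

/-- Infimum `h̲` of all edge weights. -/
def weightInf (G : ℕ → SimpleGraph (Fin n)) (h : ℕ → Fin n → Fin n → ℝ) : ℝ :=
  sInf {r | ∃ k i j, (G k).Adj i j ∧ r = h k i j}

open Classical in
/-- Smallest nonzero eigenvalue of the Laplacian of `G`. -/
def lapMin (G : SimpleGraph (Fin n)) : ℝ :=
  sInf {r | r ≠ 0 ∧ Module.End.HasEigenvalue (Matrix.toLin' (G.lapMatrix ℝ)) r}

/-- `λ̲ = inf_t λ_min` of the Laplacian of the union graph at time `tB`. -/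
def lapInf (G : ℕ → SimpleGraph (Fin n)) (B : ℕ) : ℝ := ⨅ t : ℕ, lapMin (unionGraph G B (t * B))

open Classical in
/-- `η̃ = max_t` of the maximum degree of the union graph at time `tB`. -/
def degMax (G : ℕ → SimpleGraph (Fin n)) (B : ℕ) : ℕ :=
  ⨆ t : ℕ, (unionGraph G B (t * B)).maxDegree

def theta₁ (β L c₁ : ℝ) : ℝ := min (β * (1 - β * L)) c₁

def theta₂ (β L c₂ : ℝ) : ℝ := min ((1 / β - L) / 2) c₂

/-- `τ = 3 B L² η̃ / θ₂ + 3 / (h̲ θ₁)`. -/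
def tau (G : ℕ → SimpleGraph (Fin n)) (h : ℕ → Fin n → Fin n → ℝ) (B : ℕ)
    (β L c₁ c₂ : ℝ) : ℝ :=
  3 * B * L ^ 2 * degMax G B / theta₂ β L c₂ + 3 / (weightInf G h * theta₁ β L c₁)

end FDGMAA

end

/-! Each conjugate `d_i` of a `μ`-strongly convex function is differentiable with a `1/μ`-Lipschitz
gradient. Lower semicontinuity is not assumed, so the supremum need not be attained at every `w`;
the gradient is then the common limit of all maximizing sequences, and `ConjFacts` collects the
inequalities that survive this.

The half steps on an edge preserve `w_i + w_j`, so feasibility persists. Whether the Anderson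
candidate passes the safe-guard or the plain step replaces it, the pair lowers the quadratic model
by at least `θ₁` times the squared gradient disagreement, and also by at least `θ₂` times the
squared step length (`model_halfStep_le`). Jensen's inequality carries both estimates to `D`
(`descent_step`).

An edge of a union graph may be idle at the start of its window. Its disagreement there is compared
with that at a time when the edge is active; the Lipschitz gradient bounds the drift by the step
lengths. Everything is thus paid for by the decrease of `D` over the window, at the price `τ`
(`window_bound`). Convexity, Cauchy–Schwarz and the spectral gap of the Laplacian bound `λ (D -
D⋆)²` by `R₀²` times the same disagreement (`sq_dual_gap_le`). Hence `λ aₜ² ≤ τ R₀² (aₜ - aₜ₊₁)` for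
the gaps at times `tB`, which gives the `1/t` rate (`rate_of_recursion`).

The primal bounds follow from co-coercivity at a dual solution, from Fenchel equality at `x^k`, and
from `F⋆ = -D⋆` (`strong_duality`). -/

noncomputable section

namespace FDGMAA

/-! ### Conjugates of strongly convex functions -/

section Conjugate

open Filter Topology

variable {E : Type*} [NormedAddCommGroup E] [InnerProductSpace ℝ E]
  {S : Set E} {φ : E → ℝ} {μ : ℝ} {D : E → ℝ}

/-- Strong concavity of `y ↦ ⟪w, y⟫ - φ y`. -/
lemma inner_sub_strongConcave (hsc : StrongConvexOn S μ φ) (w : E) {y z : E} (hy : y ∈ S)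
    (hz : z ∈ S) {t : ℝ} (ht0 : 0 ≤ t) (ht1 : t ≤ 1) :
    (1 - t) • y + t • z ∈ S ∧
      (1 - t) * (⟪w, y⟫_ℝ - φ y) + t * (⟪w, z⟫_ℝ - φ z) + μ / 2 * (t * (1 - t)) * ‖y - z‖ ^ 2 ≤
        ⟪w, (1 - t) • y + t • z⟫_ℝ - φ ((1 - t) • y + t • z) := by
  refine ⟨hsc.1 hy hz (by linarith) ht0 (by ring), ?_⟩
  have := hsc.2 hy hz (by linarith : 0 ≤ 1 - t) ht0 (by ring)
  simp only [smul_eq_mul] at this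
  rw [inner_add_right, inner_smul_right, inner_smul_right]
  nlinarith

/-- If `a + (1 - t) * b ≤ c` for all small `t > 0`, then `a + b ≤ c`. -/
lemma add_le_of_forall_one_sub_mul {a b c : ℝ}
    (h : ∀ t : ℝ, 0 < t → t ≤ 1 → a + (1 - t) * b ≤ c) : a + b ≤ c := by
  have hlim : Tendsto (fun t : ℝ => a + (1 - t) * b) (𝓝[>] 0) (𝓝 (a + (1 - 0) * b)) := by
    refine Tendsto.mono_left ?_ nhdsWithin_le_nhds
    exact Continuous.tendsto (by fun_prop) 0
  have := le_of_tendsto hlim (b := c) (by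
    filter_upwards [Ioc_mem_nhdsGT (zero_lt_one' ℝ)] with t ht using h t ht.1 ht.2)
  simpa using this

/-- Quadratic growth away from a maximizer. -/
lemma quadratic_growth_of_max (hsc : StrongConvexOn S μ φ) {w x y : E} (hx : x ∈ S) (hy : y ∈ S)
    (hmax : ∀ z ∈ S, ⟪w, z⟫_ℝ - φ z ≤ ⟪w, x⟫_ℝ - φ x) :
    ⟪w, y⟫_ℝ - φ y + μ / 2 * ‖x - y‖ ^ 2 ≤ ⟪w, x⟫_ℝ - φ x := by
  refine add_le_of_forall_one_sub_mul fun t ht ht1 => ?_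
  obtain ⟨hm, hle⟩ := inner_sub_strongConcave hsc w hx hy ht.le ht1
  have := hle.trans (hmax _ hm)
  nlinarith

/-- Young's inequality, by completing a square. Here the convexity modulus `μ` turns into the
smoothness constant `1/μ`. -/
lemma inner_sub_quadratic_le (hμ : 0 < μ) (v a : E) :
    ⟪v, a⟫_ℝ - μ / 2 * ‖a‖ ^ 2 ≤ 1 / (2 * μ) * ‖v‖ ^ 2 := by
  have h1 := real_inner_le_norm v a
  have h2 : 1 / (2 * μ) * ‖v‖ ^ 2 - (‖v‖ * ‖a‖ - μ / 2 * ‖a‖ ^ 2) =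
      (‖v‖ - μ * ‖a‖) ^ 2 / (2 * μ) := by
    field_simp; ring
  have h3 : 0 ≤ (‖v‖ - μ * ‖a‖) ^ 2 / (2 * μ) := by positivity
  linarith

/-- If one supremum defining the conjugate is attained, all of them are finite. -/
lemma bddAbove_inner_sub (hμ : 0 < μ) (hsc : StrongConvexOn S μ φ) {w₀ x₀ : E} (hx : x₀ ∈ S)
    (hmax : ∀ z ∈ S, ⟪w₀, z⟫_ℝ - φ z ≤ ⟪w₀, x₀⟫_ℝ - φ x₀) (w : E) :
    BddAbove ((fun y => ⟪w, y⟫_ℝ - φ y) '' S) := by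
  refine ⟨⟪w, x₀⟫_ℝ - φ x₀ + 1 / (2 * μ) * ‖w - w₀‖ ^ 2, ?_⟩
  rintro _ ⟨y, hy, rfl⟩
  -- Quadratic growth at `w₀` absorbs the linear perturbation `w - w₀`.
  have h1 := quadratic_growth_of_max hsc hx hy hmax
  have h2 := inner_sub_quadratic_le hμ (w - w₀) (y - x₀)
  rw [norm_sub_rev] at h1
  simp only [inner_sub_left, inner_sub_right] at h2 ⊢
  linarith

/-- The maximizing sequences of `⟪w, ·⟫ - φ` on `S` converge to a common limit `g`, which behaves
as a maximizer. -/
lemma exists_generalized_maximizer [CompleteSpace E] (hμ : 0 < μ) (hsc : StrongConvexOn S μ φ)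
    (hne : S.Nonempty) (w : E) {D : ℝ} (hD : IsLUB ((fun y => ⟪w, y⟫_ℝ - φ y) '' S) D) :
    ∃ g : E, (∃ y : ℕ → E, (∀ k, y k ∈ S) ∧ Tendsto y atTop (𝓝 g) ∧
        Tendsto (fun k => ⟪w, y k⟫_ℝ - φ (y k)) atTop (𝓝 D)) ∧
      ∀ y ∈ S, ⟪w, y⟫_ℝ - φ y + μ / 2 * ‖g - y‖ ^ 2 ≤ D := by
  have hub : ∀ y ∈ S, ⟪w, y⟫_ℝ - φ y ≤ D := fun y hy => hD.1 ⟨y, hy, rfl⟩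
  obtain ⟨u, -, -, hulim, humem⟩ := hD.exists_seq_monotone_tendsto (hne.image _)
  choose y hyS hyu using humem
  have hval : Tendsto (fun k => ⟪w, y k⟫_ℝ - φ (y k)) atTop (𝓝 D) := by
    simpa only [hyu] using hulim
  -- The midpoint of two near-maximizers cannot exceed `D`, so they are close; a maximizing sequence
  -- is therefore Cauchy.
  have hmid : ∀ a ∈ S, ∀ b ∈ S, μ / 4 * ‖a - b‖ ^ 2 ≤
      (D - (⟪w, a⟫_ℝ - φ a)) + (D - (⟪w, b⟫_ℝ - φ b)) := by
    intro a ha b hb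
    obtain ⟨hm, hle⟩ := inner_sub_strongConcave hsc w ha hb (t := 1 / 2) (by norm_num) (by norm_num)
    have := hle.trans (hub _ hm)
    linarith
  have hcau : CauchySeq y := by
    rw [Metric.cauchySeq_iff]
    intro ε hε
    have hev : ∀ᶠ k in atTop, D - μ / 8 * ε ^ 2 < ⟪w, y k⟫_ℝ - φ (y k) :=
      hval.eventually (lt_mem_nhds (by have : 0 < μ / 8 * ε ^ 2 := by positivity
                                       linarith))
    obtain ⟨N, hN⟩ := eventually_atTop.1 hev
    refine ⟨N, fun p hp q hq => ?_⟩
    have h1 := hmid _ (hyS p) _ (hyS q)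
    have h2 := hN p hp
    have h3 := hN q hq
    rw [dist_eq_norm]
    have h4 : μ / 4 * ‖y p - y q‖ ^ 2 < μ / 4 * ε ^ 2 := by linarith
    have h5 : ‖y p - y q‖ ^ 2 < ε ^ 2 := lt_of_mul_lt_mul_left h4 (by positivity)
    exact lt_of_pow_lt_pow_left₀ 2 hε.le h5
  obtain ⟨g, hg⟩ := cauchySeq_tendsto_of_complete hcau
  refine ⟨g, ⟨y, hyS, hg, hval⟩, fun z hz => ?_⟩
  -- Test the segment from `y k` to `z`: first `k → ∞`, then divide by `t` and let `t → 0`.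
  refine add_le_of_forall_one_sub_mul fun t ht ht1 => ?_
  have hlim : Tendsto (fun k => (1 - t) * (⟪w, y k⟫_ℝ - φ (y k)) + t * (⟪w, z⟫_ℝ - φ z) +
      μ / 2 * (t * (1 - t)) * ‖y k - z‖ ^ 2) atTop (𝓝 ((1 - t) * D + t * (⟪w, z⟫_ℝ - φ z) +
      μ / 2 * (t * (1 - t)) * ‖g - z‖ ^ 2)) :=
    ((hval.const_mul _).add_const _).add (((hg.sub_const z).norm.pow 2).const_mul _)
  have hle := le_of_tendsto' hlim (b := D) fun k => by
    obtain ⟨hm, hle⟩ := inner_sub_strongConcave hsc w (hyS k) hz ht.le ht1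
    exact hle.trans (hub _ hm)
  have : t * (⟪w, z⟫_ℝ - φ z + (1 - t) * (μ / 2 * ‖g - z‖ ^ 2)) ≤ t * D := by linarith
  exact le_of_mul_le_mul_left this ht

/-- A function squeezed between an affine function and its quadratic perturbation is
differentiable. -/
lemma hasGradientAt_of_quadratic_bounds [CompleteSpace E] {D : E → ℝ} {w g : E} {C : ℝ}
    (hlo : ∀ v, D w + ⟪g, v - w⟫_ℝ ≤ D v)
    (hup : ∀ v, D v ≤ D w + ⟪g, v - w⟫_ℝ + C * ‖v - w‖ ^ 2) : HasGradientAt D g w := by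
  rw [hasGradientAt_iff_isLittleO]
  have h1 : (fun v => D v - D w - ⟪g, v - w⟫_ℝ) =O[𝓝 w] fun v => ‖v - w‖ ^ 2 := by
    refine Asymptotics.IsBigO.of_bound C (Eventually.of_forall fun v => ?_)
    rw [Real.norm_of_nonneg (by linarith [hlo v]), Real.norm_of_nonneg (by positivity)]
    linarith [hup v]
  refine h1.trans_isLittleO ?_
  have h2 : (fun v : E => v - w) =o[𝓝 w] fun _ => (1 : ℝ) := by
    rw [Asymptotics.isLittleO_one_iff]
    have : Tendsto (fun v : E => v - w) (𝓝 w) (𝓝 (w - w)) := Continuous.tendsto (by fun_prop) w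
    simpa using this
  have h3 := h2.norm_left.mul_isBigO 
    (Asymptotics.isBigO_refl (fun v : E => ‖v - w‖) (𝓝 w))
  simpa [pow_two] using h3.norm_right

/-- Facts on the gradient of the conjugate `D` of a strongly convex `φ` on `S`: the gradient is the
generalized maximizer, and `D` has co-coercive gradient and a quadratic upper bound. -/
structure ConjFacts [CompleteSpace E] (S : Set E) (φ : E → ℝ) (μ : ℝ) (D : E → ℝ) : Prop where
  growth : ∀ w, ∀ y ∈ S, ⟪w, y⟫_ℝ - φ y + μ / 2 * ‖gradient D w - y‖ ^ 2 ≤ D w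
  approx : ∀ w, ∃ y : ℕ → E, (∀ k, y k ∈ S) ∧ Tendsto y atTop (𝓝 (gradient D w)) ∧
    Tendsto (fun k => ⟪w, y k⟫_ℝ - φ (y k)) atTop (𝓝 (D w))
  coercive : ∀ v w, D v + ⟪gradient D v, w - v⟫_ℝ +
    μ / 2 * ‖gradient D w - gradient D v‖ ^ 2 ≤ D w
  smooth : ∀ v w, D w ≤ D v + ⟪gradient D v, w - v⟫_ℝ + 1 / (2 * μ) * ‖w - v‖ ^ 2

/-- Growth at `w`, tested along a maximizing sequence for `v`, gives co-coercivity; growth at `v`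
plus Young's inequality gives the quadratic upper bound. Together they squeeze `D` and identify the
generalized maximizer as the gradient. -/
lemma conjFacts [CompleteSpace E] (hμ : 0 < μ) (hsc : StrongConvexOn S μ φ) (hne : S.Nonempty)
    (hD : ∀ w, IsLUB ((fun y => ⟪w, y⟫_ℝ - φ y) '' S) (D w)) : ConjFacts S φ μ D := by
  choose g hseq hgrow using fun w => exists_generalized_maximizer hμ hsc hne w (hD w)
  have hco : ∀ v w, D v + ⟪g v, w - v⟫_ℝ + μ / 2 * ‖g w - g v‖ ^ 2 ≤ D w := by
    intro v w
    obtain ⟨y, hyS, hylim, hyval⟩ := hseq v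
    have hlim : Tendsto (fun k => (⟪v, y k⟫_ℝ - φ (y k)) + ⟪y k, w - v⟫_ℝ +
        μ / 2 * ‖g w - y k‖ ^ 2) atTop
        (𝓝 (D v + ⟪g v, w - v⟫_ℝ + μ / 2 * ‖g w - g v‖ ^ 2)) :=
      (hyval.add (hylim.inner tendsto_const_nhds)).add
        (((tendsto_const_nhds.sub hylim).norm.pow 2).const_mul _)
    refine le_of_tendsto' hlim fun k => ?_
    have := hgrow w (y k) (hyS k)
    rw [inner_sub_right, real_inner_comm w, real_inner_comm v]
    linarith
  have hlo : ∀ v w, D v + ⟪g v, w - v⟫_ℝ ≤ D w := fun v w => by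
    have := hco v w
    have : 0 ≤ μ / 2 * ‖g w - g v‖ ^ 2 := by positivity
    linarith
  have hup : ∀ v w, D w ≤ D v + ⟪g v, w - v⟫_ℝ + 1 / (2 * μ) * ‖w - v‖ ^ 2 := by
    intro v w
    refine (hD w).2 ?_
    rintro _ ⟨y, hy, rfl⟩
    have h1 := hgrow v y hy
    have h2 := inner_sub_quadratic_le hμ (w - v) (y - g v)
    rw [norm_sub_rev y] at h2
    rw [real_inner_comm]
    simp only [inner_sub_left, inner_sub_right] at h2 ⊢
    linarith
  have hgrad : ∀ w, gradient D w = g w := fun w =>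
    (hasGradientAt_of_quadratic_bounds (hlo w) (hup w)).gradient
  refine ⟨?_, ?_, ?_, ?_⟩ <;> simp only [hgrad] <;> assumption

namespace ConjFacts

variable [CompleteSpace E] (H : ConjFacts S φ μ D)
include H

lemma convex_lower (hμ : 0 < μ) (v w : E) : D v + ⟪gradient D v, w - v⟫_ℝ ≤ D w := by
  have := H.coercive v w
  have : 0 ≤ μ / 2 * ‖gradient D w - gradient D v‖ ^ 2 := by positivity
  linarith

lemma gradient_eq_of_max (hμ : 0 < μ) {w x : E} (hx : x ∈ S) (hmax : D w = ⟪w, x⟫_ℝ - φ x) :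
    gradient D w = x := by
  have h1 := H.growth w x hx
  have h2 : μ / 2 * ‖gradient D w - x‖ ^ 2 ≤ 0 := by linarith
  have h3 : ‖gradient D w - x‖ ^ 2 ≤ 0 := nonpos_of_mul_nonpos_right h2 (by positivity)
  have h4 : ‖gradient D w - x‖ = 0 := by
    have := le_antisymm h3 (by positivity)
    simpa using this
  exact sub_eq_zero.1 (norm_eq_zero.1 h4)

/-- Adding `coercive` in both directions gives `μ ‖Δ‖² ≤ ⟪Δ, v - w⟫` for the gradient difference
`Δ`; conclude by Cauchy–Schwarz. -/
lemma gradient_lipschitz (hμ : 0 < μ) (v w : E) :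
    ‖gradient D v - gradient D w‖ ≤ 1 / μ * ‖v - w‖ := by
  have h1 := H.coercive v w
  have h2 := H.coercive w v
  have h3 := real_inner_le_norm (gradient D v - gradient D w) (v - w)
  rw [norm_sub_rev] at h1
  have h4 : μ * ‖gradient D v - gradient D w‖ ^ 2 ≤
      ‖gradient D v - gradient D w‖ * ‖v - w‖ := by
    refine le_trans ?_ h3
    simp only [inner_sub_left, inner_sub_right] at h1 h2 ⊢
    linarith
  rcases (norm_nonneg (gradient D v - gradient D w)).eq_or_lt with h0 | h0
  · rw [← h0]; positivity
  · have : μ * ‖gradient D v - gradient D w‖ ≤ ‖v - w‖ := by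
      refine le_of_mul_le_mul_left ?_ h0
      linarith
    rw [one_div, ← div_eq_inv_mul, le_div_iff₀ hμ]
    linarith

lemma continuous (hμ : 0 < μ) : Continuous D := by
  rw [continuous_iff_continuousAt]
  intro w
  exact (hasGradientAt_of_quadratic_bounds (H.convex_lower hμ w)
    (H.smooth w)).differentiableAt.continuousAt

/-- Jensen's inequality for the points `u j` with weights `h j`, the remaining weight being put on
`w`. -/
lemma jensen (hμ : 0 < μ) {ι : Type*} (s : Finset ι) (h : ι → ℝ) (hh : ∀ j ∈ s, 0 ≤ h j)
    (hs : ∑ j ∈ s, h j ≤ 1) (w : E) (u : ι → E) :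
    D ((1 - ∑ j ∈ s, h j) • w + ∑ j ∈ s, h j • u j) ≤
      (1 - ∑ j ∈ s, h j) * D w + ∑ j ∈ s, h j * D (u j) := by
  -- Average the tangent inequalities at the barycentre `p`; their linear terms cancel.
  set p := (1 - ∑ j ∈ s, h j) • w + ∑ j ∈ s, h j • u j with hp
  have h0 := mul_le_mul_of_nonneg_left (H.convex_lower hμ p w) (sub_nonneg.2 hs)
  have h1 : ∑ j ∈ s, h j * (D p + ⟪gradient D p, u j - p⟫_ℝ) ≤ ∑ j ∈ s, h j * D (u j) :=
    Finset.sum_le_sum fun j hj => mul_le_mul_of_nonneg_left (H.convex_lower hμ p (u j)) (hh j hj)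
  have h2 : ⟪gradient D p, p⟫_ℝ = (1 - ∑ j ∈ s, h j) * ⟪gradient D p, w⟫_ℝ +
      ∑ j ∈ s, h j * ⟪gradient D p, u j⟫_ℝ := by
    conv_lhs => rw [hp]
    rw [inner_add_right, inner_smul_right, inner_sum]
    simp only [inner_smul_right]
    rfl
  simp only [inner_sub_right, mul_add, mul_sub, Finset.sum_add_distrib, Finset.sum_sub_distrib,
    ← Finset.sum_mul] at h0 h1
  linarith

end ConjFacts

end Conjugate

/-! ### Passing from extended-real to real values -/

section ExtendedReal

variable {d : ℕ} {f : Vec d → EReal}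

lemma coe_toReal_of_mem_dom (hbot : ∀ x, f x ≠ ⊥) {y : Vec d} (hy : y ∈ dom f) :
    ((f y).toReal : EReal) = f y :=
  EReal.coe_toReal hy (hbot y)

lemma inner_sub_of_mem_dom (hbot : ∀ x, f x ≠ ⊥) (w : Vec d) {y : Vec d} (hy : y ∈ dom f) :
    ((⟪w, y⟫_ℝ : ℝ) : EReal) - f y = ((⟪w, y⟫_ℝ - (f y).toReal : ℝ) : EReal) := by
  rw [EReal.coe_sub, coe_toReal_of_mem_dom hbot hy]

lemma inner_sub_of_notMem_dom (w : Vec d) {y : Vec d} (hy : y ∉ dom f) :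
    ((⟪w, y⟫_ℝ : ℝ) : EReal) - f y = ⊥ := by
  have : f y = ⊤ := by simpa [dom] using hy
  rw [this, EReal.sub_top]

lemma IsConjMaximizer.mem_dom (hbot : ∀ x, f x ≠ ⊥) (hne : (dom f).Nonempty) {w x : Vec d}
    (hx : IsConjMaximizer f w x) : x ∈ dom f := by
  by_contra hxd
  obtain ⟨y, hy⟩ := hne
  have := hx y
  rw [inner_sub_of_notMem_dom w hxd, inner_sub_of_mem_dom hbot w hy, le_bot_iff] at this
  exact EReal.coe_ne_bot _ this

lemma IsConjMaximizer.real_le (hbot : ∀ x, f x ≠ ⊥) (hne : (dom f).Nonempty) {w x : Vec d}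
    (hx : IsConjMaximizer f w x) (y : Vec d) (hy : y ∈ dom f) :
    ⟪w, y⟫_ℝ - (f y).toReal ≤ ⟪w, x⟫_ℝ - (f x).toReal := by
  have := hx y
  rw [inner_sub_of_mem_dom hbot w (hx.mem_dom hbot hne), inner_sub_of_mem_dom hbot w hy] at this
  exact_mod_cast this

/-- Points outside the domain contribute `⊥` to the supremum, so they do not affect it once the
domain is nonempty. -/
lemma conj_eq_coe_of_isLUB (hbot : ∀ x, f x ≠ ⊥) (hne : (dom f).Nonempty) (w : Vec d) {D : ℝ}
    (hD : IsLUB ((fun y => ⟪w, y⟫_ℝ - (f y).toReal) '' dom f) D) : conj f w = D := by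
  refine le_antisymm (iSup_le fun y => ?_) ?_
  · by_cases hy : y ∈ dom f
    · rw [inner_sub_of_mem_dom hbot w hy]
      exact_mod_cast hD.1 ⟨y, hy, rfl⟩
    · rw [inner_sub_of_notMem_dom w hy]
      exact bot_le
  · refine le_of_forall_lt fun c hc => ?_
    induction c using EReal.rec with
    | bot =>
      obtain ⟨y, hy⟩ := hne
      refine lt_of_lt_of_le ?_ (le_iSup _ y)
      rw [inner_sub_of_mem_dom hbot w hy]
      exact EReal.bot_lt_coe _
    | top => exact absurd hc (not_lt.2 le_top)
    | coe c =>
      obtain ⟨_, ⟨y, hy, rfl⟩, hcy, -⟩ := hD.exists_between (EReal.coe_lt_coe_iff.1 hc)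
      refine lt_of_lt_of_le ?_ (le_iSup _ y)
      rw [inner_sub_of_mem_dom hbot w hy]
      exact_mod_cast hcy

/-- One attained supremum suffices: strong convexity then bounds all the others. -/
lemma isLUB_dual (hbot : ∀ x, f x ≠ ⊥) {μ : ℝ} (hμ : 0 < μ)
    (hsc : StrongConvexOn (dom f) μ (fun x => (f x).toReal)) (hne : (dom f).Nonempty)
    {w₀ x₀ : Vec d} (hx : IsConjMaximizer f w₀ x₀) (w : Vec d) :
    IsLUB ((fun y => ⟪w, y⟫_ℝ - (f y).toReal) '' dom f) (dual f w) := by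
  have hbdd := bddAbove_inner_sub hμ hsc (hx.mem_dom hbot hne) (hx.real_le hbot hne) w
  have hlub := isLUB_csSup (hne.image _) hbdd
  have : dual f w = sSup ((fun y => ⟪w, y⟫_ℝ - (f y).toReal) '' dom f) := by
    rw [dual, conj_eq_coe_of_isLUB hbot hne w hlub, EReal.toReal_coe]
  rwa [this]

lemma IsConjMaximizer.dual_eq (hbot : ∀ x, f x ≠ ⊥) (hne : (dom f).Nonempty) {w x : Vec d}
    (hx : IsConjMaximizer f w x)
    (hD : IsLUB ((fun y => ⟪w, y⟫_ℝ - (f y).toReal) '' dom f) (dual f w)) :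
    dual f w = ⟪w, x⟫_ℝ - (f x).toReal := by
  refine hD.unique ⟨?_, fun b hb => hb ⟨x, hx.mem_dom hbot hne, rfl⟩⟩
  rintro _ ⟨y, hy, rfl⟩
  exact hx.real_le hbot hne y hy

variable {n : ℕ} {g : Fin n → Vec d → EReal}

lemma primalObj_eq_coe (hbot : ∀ i x, g i x ≠ ⊥) {x : Stack n d} (hx : ∀ i, x i ∈ dom (g i)) :
    primalObj g x = ((∑ i, (g i (x i)).toReal : ℝ) : EReal) := by
  have hcoe : ∀ s : Finset (Fin n), ∑ i ∈ s, g i (x i) =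
      ((∑ i ∈ s, (g i (x i)).toReal : ℝ) : EReal) := by
    intro s
    induction s using Finset.induction_on with
    | empty => simp
    | insert a s ha ih =>
      rw [Finset.sum_insert ha, Finset.sum_insert ha, ih, EReal.coe_add,
        coe_toReal_of_mem_dom (hbot a) (hx a)]
  exact hcoe _

/-- With no summand equal to `⊥`, a single `⊤` cannot be cancelled. -/
lemma mem_dom_of_primalObj_ne_top (hbot : ∀ i x, g i x ≠ ⊥) {x : Stack n d}
    (hx : primalObj g x ≠ ⊤) (i : Fin n) : x i ∈ dom (g i) := by
  intro hi
  refine hx ?_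
  have hb : ∀ s : Finset (Fin n), ∑ j ∈ s, g j (x j) ≠ ⊥ := by
    intro s
    induction s using Finset.induction_on with
    | empty => simp
    | insert a s ha ih =>
      rw [Finset.sum_insert ha]
      exact EReal.add_ne_bot_iff.2 ⟨hbot a _, ih⟩
  rw [primalObj, ← Finset.add_sum_erase _ _ (Finset.mem_univ i), hi,
    EReal.top_add_of_ne_bot (hb _)]

end ExtendedReal

/-! ### Duality -/

section Duality

open Filter Topology

/-- Radial limits of a convex function bounded near an interior point `z`: along the segment from
`z` to a limit `g` of points of the domain, the function is controlled by the limiting values. -/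
lemma radial_le {E : Type*} [NormedAddCommGroup E] [NormedSpace ℝ E] {S : Set E} {φ : E → ℝ}
    (hφ : ConvexOn ℝ S φ) {z : E} {r M : ℝ} (hr : 0 < r)
    (hball : ∀ y, ‖y - z‖ ≤ r → y ∈ S ∧ φ y ≤ M) {y : ℕ → E} (hy : ∀ k, y k ∈ S) {g : E} {c : ℝ}
    (hg : Tendsto y atTop (𝓝 g)) (hc : Tendsto (fun k => φ (y k)) atTop (𝓝 c)) {t : ℝ}
    (ht : 0 < t) (ht1 : t ≤ 1) :
    (1 - t) • g + t • z ∈ S ∧ φ ((1 - t) • g + t • z) ≤ (1 - t) * c + t * M := by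
  have hz : Tendsto (fun k => ‖((1 - t) / t) • (g - y k)‖) atTop (𝓝 0) := by
    have : Tendsto (fun k => ‖((1 - t) / t) • (g - y k)‖) atTop
        (𝓝 ‖((1 - t) / t) • (g - g)‖) :=
      ((tendsto_const_nhds.sub hg).const_smul _).norm
    simpa using this
  have hev : ∀ᶠ k in atTop, (1 - t) • g + t • z ∈ S ∧
      φ ((1 - t) • g + t • z) ≤ (1 - t) * φ (y k) + t * M := by
    filter_upwards [hz.eventually (gt_mem_nhds hr)] with k hk
    have hzk := hball (z + ((1 - t) / t) • (g - y k)) (by simpa using hk.le)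
    -- The error `g - y k` is moved into the ball around `z`, so that convexity is applied at points
    -- of the domain only.
    have hp : (1 - t) • g + t • z = (1 - t) • y k + t • (z + ((1 - t) / t) • (g - y k)) := by
      rw [smul_add, smul_smul, mul_div_cancel₀ _ ht.ne', smul_sub]
      abel
    rw [hp]
    refine ⟨hφ.1 (hy k) hzk.1 (by linarith) ht.le (by ring), ?_⟩
    have h1 := hφ.2 (hy k) hzk.1 (by linarith : 0 ≤ 1 - t) ht.le (by ring)
    simp only [smul_eq_mul] at h1
    nlinarith [mul_le_mul_of_nonneg_left hzk.2 ht.le]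
  obtain ⟨k, hk⟩ := hev.exists
  exact ⟨hk.1, ge_of_tendsto ((hc.const_mul _).add_const _) (hev.mono fun k hk => hk.2)⟩

variable {n d : ℕ} {f : Fin n → Vec d → EReal} {μ : ℝ}

/-- A convex function on a finite-dimensional space is continuous in the interior of its domain. The
ball serves both the coercivity of `D` and the radial argument in `strong_duality`. -/
lemma exists_ball_bound (hμ : 0 < μ)
    (hconv : ∀ i, StrongConvexOn (dom (f i)) μ (fun x => (f i x).toReal))
    (hint : (interior (⋂ i, dom (f i))).Nonempty) :
    ∃ z : Vec d, ∃ r > 0, ∃ M : ℝ, ∀ i, ∀ y, ‖y - z‖ ≤ r →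
      y ∈ dom (f i) ∧ (f i y).toReal ≤ M := by
  obtain ⟨z, hz⟩ := hint
  have hev : ∀ i, ∀ᶠ y in 𝓝 z, y ∈ dom (f i) ∧ (f i y).toReal ≤ (f i z).toReal + 1 := by
    intro i
    have hzi : z ∈ interior (dom (f i)) := interior_mono (Set.iInter_subset _ i) hz
    have hc : ContinuousAt (fun x => (f i x).toReal) z :=
      ((hconv i).strictConvexOn hμ).convexOn.continuousOn_interior.continuousAt
        (isOpen_interior.mem_nhds hzi)
    filter_upwards [mem_interior_iff_mem_nhds.1 hzi,
      hc.eventually (gt_mem_nhds (lt_add_one _))] with y hy hy' using ⟨hy, hy'.le⟩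
  obtain ⟨r, hr, hball⟩ := Metric.nhds_basis_closedBall.eventually_iff.1 (eventually_all.2 hev)
  refine ⟨z, r, hr, ∑ i, (|(f i z).toReal| + 1), fun i y hy => ?_⟩
  obtain ⟨h1, h2⟩ := hball (by rwa [Metric.mem_closedBall, dist_eq_norm]) i
  refine ⟨h1, h2.trans ?_⟩
  have := Finset.single_le_sum (f := fun i => |(f i z).toReal| + 1)
    (fun j _ => by positivity) (Finset.mem_univ i)
  have h3 := le_abs_self (f i z).toReal
  linarith

variable (H : ∀ i, ConjFacts (dom (f i)) (fun x => (f i x).toReal) μ (dual (f i)))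

include H

lemma continuous_dualObj (hμ : 0 < μ) : Continuous (dualObj f) := by
  unfold dualObj
  exact continuous_finsetSum _ fun i _ => ((H i).continuous hμ).comp (by fun_prop)

/-- Testing the supremum at `z + r v / ‖v‖` gives linear growth. For `v = 0` the quotient is `0` and
the test point is `z`. -/
lemma dual_lower_bound (hμ : 0 < μ) {z : Vec d} {r M : ℝ} (hr : 0 < r) (i : Fin n)
    (hball : ∀ y, ‖y - z‖ ≤ r → y ∈ dom (f i) ∧ (f i y).toReal ≤ M) (v : Vec d) :
    ⟪v, z⟫_ℝ + r * ‖v‖ - M ≤ dual (f i) v := by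
  have hy := hball (z + (r / ‖v‖) • v) (by
    rw [add_sub_cancel_left, norm_smul, Real.norm_of_nonneg (by positivity)]
    rcases (norm_nonneg v).eq_or_lt with h0 | h0
    · rw [← h0]; simpa using hr.le
    · rw [div_mul_cancel₀ _ h0.ne'])
  have h1 := (H i).growth v _ hy.1
  have h2 : ⟪v, z + (r / ‖v‖) • v⟫_ℝ = ⟪v, z⟫_ℝ + r * ‖v‖ := by
    rw [inner_add_right, inner_smul_right, real_inner_self_eq_norm_sq]
    rcases (norm_nonneg v).eq_or_lt with h0 | h0
    · rw [← h0]; simp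
    · field_simp
  rw [h2] at h1
  have : 0 ≤ μ / 2 * ‖gradient (dual (f i)) v - (z + (r / ‖v‖) • v)‖ ^ 2 := by positivity
  linarith [hy.2]

/-- Summed over the nodes, the terms `⟪w i, z⟫` cancel by feasibility, and `r ∑ ‖w i‖` remains
bounded. -/
lemma isCompact_sublevel (hμ : 0 < μ)
    (hconv : ∀ i, StrongConvexOn (dom (f i)) μ (fun x => (f i x).toReal))
    (hint : (interior (⋂ i, dom (f i))).Nonempty) (w0 : Stack n d) :
    IsCompact (sublevel f w0) := by
  obtain ⟨z, r, hr, M, hball⟩ := exists_ball_bound hμ hconv hint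
  have hclosed : IsClosed (sublevel f w0) := by
    refine (isClosed_le (continuous_dualObj H hμ) continuous_const).inter ?_
    exact isClosed_eq (by fun_prop) continuous_const
  refine Metric.isCompact_of_isClosed_isBounded hclosed ?_
  refine isBounded_iff_forall_norm_le.2 ⟨(dualObj f w0 + n * M) / r, fun w hw => ?_⟩
  have h1 : ∑ i, (⟪w i, z⟫_ℝ + r * ‖w i‖ - M) ≤ dualObj f w :=
    Finset.sum_le_sum fun i _ => dual_lower_bound H hμ hr i (hball i) (w i)
  rw [Finset.sum_sub_distrib, Finset.sum_add_distrib, ← sum_inner,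
    (show ∑ i, w i = 0 from hw.2), inner_zero_left, ← Finset.mul_sum] at h1
  have h2 : ‖w‖ ≤ ∑ i, ‖w i‖ := by
    refine le_of_sq_le_sq ?_ (Finset.sum_nonneg fun i _ => norm_nonneg _)
    rw [PiLp.norm_sq_eq_of_L2]
    exact Finset.sum_sq_le_sq_sum_of_nonneg fun i _ => norm_nonneg _
  rw [le_div_iff₀ hr]
  simp at h1
  nlinarith [hw.1, mul_le_mul_of_nonneg_left h2 hr.le]

lemma exists_dual_minimizer (hμ : 0 < μ)
    (hconv : ∀ i, StrongConvexOn (dom (f i)) μ (fun x => (f i x).toReal))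
    (hint : (interior (⋂ i, dom (f i))).Nonempty) :
    ∃ ws ∈ dualFeasible n d, dualObj f ws = dualValue f ∧
      ∀ v ∈ dualFeasible n d, dualValue f ≤ dualObj f v := by
  have h0 : (0 : Stack n d) ∈ dualFeasible n d := by simp [dualFeasible]
  obtain ⟨ws, hws, hmin⟩ := (isCompact_sublevel H hμ hconv hint 0).exists_isMinOn
    ⟨0, le_rfl, h0⟩ (continuous_dualObj H hμ).continuousOn
  have hmin' : ∀ v ∈ dualFeasible n d, dualObj f ws ≤ dualObj f v := by
    intro v hv
    rcases le_total (dualObj f v) (dualObj f 0) with h | h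
    · exact hmin ⟨h, hv⟩
    · exact hws.1.trans h
  have hleast : IsLeast (dualObj f '' dualFeasible n d) (dualObj f ws) :=
    ⟨⟨ws, hws.2, rfl⟩, by rintro _ ⟨v, hv, rfl⟩; exact hmin' v hv⟩
  have heq : dualObj f ws = dualValue f := hleast.csInf_eq.symm
  exact ⟨ws, hws.2, heq, heq ▸ hmin'⟩

/-- Average of a family of vectors. -/
def mean (g : Fin n → Vec d) : Vec d := (1 / (n : ℝ)) • ∑ i, g i

omit H in
lemma sum_sub_mean (hn : 0 < n) (g : Fin n → Vec d) : ∑ i, (g i - mean g) = 0 := by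
  have : (n : ℝ) ≠ 0 := by positivity
  rw [Finset.sum_sub_distrib, Finset.sum_const, Finset.card_univ, Fintype.card_fin, mean,
    ← Nat.cast_smul_eq_nsmul ℝ, smul_smul, mul_one_div_cancel this, one_smul, sub_self]

omit H in
lemma sum_inner_sub_const (g e : Fin n → Vec d) (c : Vec d) (he : ∑ i, e i = 0) :
    ∑ i, ⟪g i - c, e i⟫_ℝ = ∑ i, ⟪g i, e i⟫_ℝ := by
  simp only [inner_sub_left, Finset.sum_sub_distrib]
  rw [← inner_sum, he, inner_zero_right, sub_zero]

/-- At a dual solution all the gradients agree. -/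
lemma gradient_eq_of_dual_minimizer (hμ : 0 < μ) (hn : 0 < n) {ws : Stack n d}
    (hws : ws ∈ dualFeasible n d) (hmin : ∀ v ∈ dualFeasible n d, dualObj f ws ≤ dualObj f v) :
    ∃ xs : Vec d, ∀ i, gradient (dual (f i)) (ws i) = xs := by
  set g : Fin n → Vec d := fun i => gradient (dual (f i)) (ws i) with hg
  refine ⟨mean g, ?_⟩
  have hsum := sum_sub_mean hn g
  set Q := ∑ i, ‖g i - mean g‖ ^ 2 with hQ
  have hgQ : ∑ i, ⟪g i, g i - mean g⟫_ℝ = Q := by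
    rw [← sum_inner_sub_const g (fun i => g i - mean g) (mean g) hsum]
    simp only [real_inner_self_eq_norm_sq, hQ]
  -- A projected gradient step of length `μ = 1/L`: it stays feasible and lowers `D` by at least
  -- `μ/2 * Q`, so minimality forces `Q = 0`.
  let v : Stack n d := WithLp.toLp 2 fun i => ws i - μ • (g i - mean g)
  have hv : v ∈ dualFeasible n d := by
    change ∑ i, (ws i - μ • (g i - mean g)) = 0
    rw [Finset.sum_sub_distrib, ← Finset.smul_sum, hsum, smul_zero, sub_zero]
    exact hws
  have h1 : dualObj f v ≤ dualObj f ws - μ * Q + 1 / (2 * μ) * (μ ^ 2 * Q) := by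
    have : dualObj f v ≤ ∑ i, (dual (f i) (ws i) + ⟪g i, v i - ws i⟫_ℝ +
        1 / (2 * μ) * ‖v i - ws i‖ ^ 2) :=
      Finset.sum_le_sum fun i _ => (H i).smooth (ws i) (v i)
    refine this.trans (le_of_eq ?_)
    have hvi : ∀ i, v i - ws i = -(μ • (g i - mean g)) := fun i => by
      change ws i - μ • (g i - mean g) - ws i = _
      abel
    simp only [hvi, inner_neg_right, inner_smul_right, norm_neg, norm_smul, mul_pow,
      Finset.sum_add_distrib, ← Finset.mul_sum, Finset.sum_neg_distrib, Real.norm_eq_abs, sq_abs]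
    rw [← hQ, hgQ, dualObj]
    ring
  have h2 := hmin v hv
  have h3 : 1 / (2 * μ) * (μ ^ 2 * Q) = μ / 2 * Q := by field_simp
  have h4 : Q ≤ 0 := by
    by_contra! h
    have : 0 < μ * Q := by positivity
    linarith
  have h5 : Q = 0 := le_antisymm h4 (Finset.sum_nonneg fun i _ => by positivity)
  intro i
  have := (Finset.sum_eq_zero_iff_of_nonneg fun i _ => by positivity).1 h5 i (Finset.mem_univ i)
  simpa [sub_eq_zero] using this

/-- Weak duality with the quadratic gap. -/
lemma weak_duality (hbot : ∀ i x, f i x ≠ ⊥) {w : Stack n d} (hw : w ∈ dualFeasible n d)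
    {x : Stack n d} (hx : x ∈ consensus n d) (hxd : ∀ i, x i ∈ dom (f i)) :
    -dualObj f w + μ / 2 * ∑ i, ‖gradient (dual (f i)) (w i) - x i‖ ^ 2 ≤
      (primalObj f x).toReal := by
  rw [primalObj_eq_coe hbot hxd, EReal.toReal_coe]
  have h1 : ∑ i, (⟪w i, x i⟫_ℝ - (f i (x i)).toReal +
      μ / 2 * ‖gradient (dual (f i)) (w i) - x i‖ ^ 2) ≤ dualObj f w :=
    Finset.sum_le_sum fun i _ => (H i).growth (w i) (x i) (hxd i)
  have h2 : ∑ i, ⟪w i, x i⟫_ℝ = 0 := by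
    rcases Nat.eq_zero_or_pos n with rfl | hn
    · simp
    · have : ∀ i, x i = x ⟨0, hn⟩ := fun i => hx i _
      simp only [this]
      rw [← sum_inner, (show ∑ i, w i = 0 from hw), inner_zero_left]
  rw [Finset.sum_add_distrib, Finset.sum_sub_distrib, h2, ← Finset.mul_sum] at h1
  linarith

/-- The common gradient `xs` at a dual solution may lie outside the domains. It is approached along
the segment from the interior point `z`, where `radial_le` bounds the objective by values tending to
`-D⋆`. -/
lemma strong_duality (hbot : ∀ i x, f i x ≠ ⊥) (hμ : 0 < μ) (hn : 0 < n)
    (hconv : ∀ i, StrongConvexOn (dom (f i)) μ (fun x => (f i x).toReal))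
    (hint : (interior (⋂ i, dom (f i))).Nonempty) :
    primalValue f = ((-dualValue f : ℝ) : EReal) := by
  obtain ⟨ws, hws, hval, hmin⟩ := exists_dual_minimizer H hμ hconv hint
  obtain ⟨xs, hxs⟩ := gradient_eq_of_dual_minimizer H hμ hn hws (hval ▸ hmin)
  obtain ⟨z, r, hr, M, hball⟩ := exists_ball_bound hμ hconv hint
  have hweak : ((-dualValue f : ℝ) : EReal) ≤ primalValue f := by
    refine le_iInf₂ fun x hx => ?_
    by_cases htop : primalObj f x = ⊤
    · rw [htop]; exact le_top
    have hxd := mem_dom_of_primalObj_ne_top hbot htop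
    have := weak_duality H hbot hws hx hxd
    rw [primalObj_eq_coe hbot hxd, EReal.toReal_coe, hval] at this
    rw [primalObj_eq_coe hbot hxd]
    have h0 : 0 ≤ μ / 2 * ∑ i, ‖gradient (dual (f i)) (ws i) - x i‖ ^ 2 := by positivity
    exact_mod_cast (by linarith : -dualValue f ≤ ∑ i, (f i (x i)).toReal)
  have hc : ∑ i, (⟪ws i, xs⟫_ℝ - dual (f i) (ws i)) = -dualValue f := by
    rw [Finset.sum_sub_distrib, ← sum_inner, (show ∑ i, ws i = 0 from hws), inner_zero_left,
      ← hval, dualObj, zero_sub]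
  have hrad : ∀ t : ℝ, 0 < t → t ≤ 1 → primalValue f ≤
      (((1 - t) * -dualValue f + t * (n * M) : ℝ) : EReal) := by
    intro t ht ht1
    have hp : ∀ i, (1 - t) • xs + t • z ∈ dom (f i) ∧ (f i ((1 - t) • xs + t • z)).toReal ≤
        (1 - t) * (⟪ws i, xs⟫_ℝ - dual (f i) (ws i)) + t * M := by
      intro i
      obtain ⟨y, hy, hylim, hyval⟩ := (H i).approx (ws i)
      rw [hxs i] at hylim
      refine radial_le ((hconv i).strictConvexOn hμ).convexOn hr (hball i) hy hylim ?_ ht ht1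
      have := (tendsto_const_nhds.inner hylim : Tendsto (fun k => ⟪ws i, y k⟫_ℝ) atTop _).sub hyval
      simpa using this
    let p : Stack n d := WithLp.toLp 2 fun _ => (1 - t) • xs + t • z
    have hpc : p ∈ consensus n d := fun i j => rfl
    refine (iInf₂_le p hpc).trans ?_
    rw [primalObj_eq_coe hbot fun i => (hp i).1, EReal.coe_le_coe_iff]
    refine (Finset.sum_le_sum fun i _ => (hp i).2).trans (le_of_eq ?_)
    rw [Finset.sum_add_distrib, ← Finset.mul_sum, hc]
    simp
    ring
  have hne_top : primalValue f ≠ ⊤ := fun h => by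
    have := hrad 1 one_pos le_rfl
    rw [h, top_le_iff] at this
    exact EReal.coe_ne_top _ this
  have hne_bot : primalValue f ≠ ⊥ := fun h => by
    rw [h, le_bot_iff] at hweak
    exact EReal.coe_ne_bot _ hweak
  lift primalValue f to ℝ using ⟨hne_top, hne_bot⟩ with F hF
  refine le_antisymm ?_ hweak
  -- The bound `F ≤ (1 - t)(-D⋆) + t n M`, rearranged so that `1 - t` multiplies one term.
  have : (F - n * M) + (dualValue f + n * M) ≤ 0 := by
    refine add_le_of_forall_one_sub_mul fun t ht ht1 => ?_
    have := EReal.coe_le_coe_iff.1 (hrad t ht ht1)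
    linarith
  exact EReal.coe_le_coe_iff.2 (by linarith)

/-- A primal solution is the common gradient at a dual solution. -/
lemma primalSolution_eq (hbot : ∀ i x, f i x ≠ ⊥) (hμ : 0 < μ) (hn : 0 < n)
    (hconv : ∀ i, StrongConvexOn (dom (f i)) μ (fun x => (f i x).toReal))
    (hint : (interior (⋂ i, dom (f i))).Nonempty) {ws : Stack n d} (hws : ws ∈ dualFeasible n d)
    (hval : dualObj f ws = dualValue f) {x : Stack n d} (hx : IsPrimalSolution f x) (i : Fin n) :
    gradient (dual (f i)) (ws i) = x i := by
  have hle : primalObj f x ≤ primalValue f := le_iInf₂ hx.2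
  rw [strong_duality H hbot hμ hn hconv hint] at hle
  have htop : primalObj f x ≠ ⊤ := fun h => by
    rw [h, top_le_iff] at hle
    exact EReal.coe_ne_top _ hle
  have hxd := mem_dom_of_primalObj_ne_top hbot htop
  have h1 := weak_duality H hbot hws hx.1 hxd
  rw [primalObj_eq_coe hbot hxd, EReal.coe_le_coe_iff] at hle
  rw [primalObj_eq_coe hbot hxd, EReal.toReal_coe, hval] at h1
  have h2 : μ / 2 * ∑ i, ‖gradient (dual (f i)) (ws i) - x i‖ ^ 2 ≤ 0 := by linarith
  have h3 := le_antisymm (nonpos_of_mul_nonpos_right h2 (by positivity))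
    (Finset.sum_nonneg fun i _ => by positivity)
  have := (Finset.sum_eq_zero_iff_of_nonneg fun i _ => by positivity).1 h3 i (Finset.mem_univ i)
  simpa [sub_eq_zero] using this

/-- Attainment makes `xs` a true maximizer for every node, hence a point of all domains with Fenchel
equality; the equalities sum to `-D⋆`. -/
lemma existsUnique_primalSolution (hbot : ∀ i x, f i x ≠ ⊥) (hμ : 0 < μ) (hn : 0 < n)
    (hconv : ∀ i, StrongConvexOn (dom (f i)) μ (fun x => (f i x).toReal))
    (hint : (interior (⋂ i, dom (f i))).Nonempty)
    (hLUB : ∀ i v, IsLUB ((fun y => ⟪v, y⟫_ℝ - (f i y).toReal) '' dom (f i)) (dual (f i) v))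
    (hmax : ∀ i v, ∃ y, IsConjMaximizer (f i) v y) : ∃! xs, IsPrimalSolution f xs := by
  obtain ⟨ws, hws, hval, hmin⟩ := exists_dual_minimizer H hμ hconv hint
  obtain ⟨xs, hxs⟩ := gradient_eq_of_dual_minimizer H hμ hn hws (hval ▸ hmin)
  have hne : ∀ i, (dom (f i)).Nonempty := fun i =>
    (hint.mono interior_subset).mono (Set.iInter_subset _ i)
  have hmaxi : ∀ i, xs ∈ dom (f i) ∧ dual (f i) (ws i) = ⟪ws i, xs⟫_ℝ - (f i xs).toReal := by
    intro i
    obtain ⟨y, hy⟩ := hmax i (ws i)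
    have hyd := hy.mem_dom (hbot i) (hne i)
    have heq := hy.dual_eq (hbot i) (hne i) (hLUB i _)
    have : xs = y := by rw [← hxs i, (H i).gradient_eq_of_max hμ hyd heq]
    rw [this]
    exact ⟨hyd, heq⟩
  refine ⟨WithLp.toLp 2 fun _ => xs, ⟨fun i j => rfl, fun y hy => ?_⟩, fun y hy => ?_⟩
  · have h1 : primalValue f ≤ primalObj f y := iInf₂_le y hy
    refine le_trans (le_of_eq ?_) h1
    rw [strong_duality H hbot hμ hn hconv hint, primalObj_eq_coe hbot fun i => (hmaxi i).1,
      EReal.coe_eq_coe_iff]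
    have h2 : dualObj f ws = ∑ i, (⟪ws i, xs⟫_ℝ - (f i xs).toReal) :=
      Finset.sum_congr rfl fun i _ => (hmaxi i).2
    rw [Finset.sum_sub_distrib, ← sum_inner, (show ∑ i, ws i = 0 from hws), inner_zero_left,
      hval] at h2
    change ∑ i, (f i xs).toReal = _
    linarith
  · ext1 i
    exact ((primalSolution_eq H hbot hμ hn hconv hint hws hval hy i).symm.trans (hxs i))

/-- Co-coercivity at `ws`: the linear term vanishes because the gradients there agree and `w - ws`
sums to zero. -/
lemma sq_dist_gradient_le (hμ : 0 < μ) {w ws xk xs : Stack n d} (hw : w ∈ dualFeasible n d)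
    (hws : ws ∈ dualFeasible n d) (hval : dualObj f ws = dualValue f)
    (hxk : ∀ i, gradient (dual (f i)) (w i) = xk i)
    (hxs : ∀ i, gradient (dual (f i)) (ws i) = xs i) (hcons : xs ∈ consensus n d) :
    ‖xk - xs‖ ≤ Real.sqrt (2 * (1 / μ) * (dualObj f w - dualValue f)) := by
  refine Real.le_sqrt_of_sq_le ?_
  have h1 : ∑ i, (dual (f i) (ws i) + ⟪xs i, w i - ws i⟫_ℝ + μ / 2 * ‖xk i - xs i‖ ^ 2) ≤
      dualObj f w := Finset.sum_le_sum fun i _ => by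
    have := (H i).coercive (ws i) (w i)
    rwa [hxk, hxs] at this
  have h2 : ∑ i, ⟪xs i, w i - ws i⟫_ℝ = 0 := by
    rcases Nat.eq_zero_or_pos n with rfl | hn
    · simp
    · have : ∀ i, xs i = xs ⟨0, hn⟩ := fun i => hcons i _
      simp only [this]
      rw [← inner_sum, Finset.sum_sub_distrib, (show ∑ i, w i = 0 from hw),
        (show ∑ i, ws i = 0 from hws), sub_zero, inner_zero_right]
  rw [Finset.sum_add_distrib, Finset.sum_add_distrib, h2, ← Finset.mul_sum] at h1
  have h3 : ‖xk - xs‖ ^ 2 = ∑ i, ‖xk i - xs i‖ ^ 2 := by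
    rw [PiLp.norm_sq_eq_of_L2]; rfl
  have h4 : dualValue f + μ / 2 * ‖xk - xs‖ ^ 2 ≤ dualObj f w := by
    rw [h3, ← hval]
    simpa [dualObj] using h1
  have h5 : 2 * (1 / μ) * (μ / 2 * ‖xk - xs‖ ^ 2) ≤ 2 * (1 / μ) * (dualObj f w - dualValue f) :=
    mul_le_mul_of_nonneg_left (by linarith) (by positivity)
  refine le_trans (le_of_eq ?_) h5
  field_simp

/-- By Fenchel equality and strong duality the error is `⟪w, xk⟫ - (D(w) - D⋆)`, which lies between
`⟪ws, xk⟫` and `⟪w, xk⟫`. Feasible vectors are orthogonal to consensus vectors, so `xk` may be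
replaced by `xk - xs`; here `xs` is the stacked gradient at `ws` and need not be a primal solution.
-/
lemma abs_primalObj_sub_le (hbot : ∀ i x, f i x ≠ ⊥) (hμ : 0 < μ) (hn : 0 < n)
    (hconv : ∀ i, StrongConvexOn (dom (f i)) μ (fun x => (f i x).toReal))
    (hint : (interior (⋂ i, dom (f i))).Nonempty)
    {w0 w xk : Stack n d} (hw : w ∈ sublevel f w0) (hw0 : w0 ∈ dualFeasible n d)
    (hxd : ∀ i, xk i ∈ dom (f i))
    (hmax : ∀ i, dual (f i) (w i) = ⟪w i, xk i⟫_ℝ - (f i (xk i)).toReal) :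
    |(primalObj f xk).toReal - (primalValue f).toReal| ≤ (radius f w0 + ‖w0‖) *
      Real.sqrt (2 * (1 / μ) * (dualObj f w - dualValue f)) := by
  obtain ⟨ws, hws, hval, hmin⟩ := exists_dual_minimizer H hμ hconv hint
  obtain ⟨y, hy⟩ := gradient_eq_of_dual_minimizer H hμ hn hws (hval ▸ hmin)
  have hxk : ∀ i, gradient (dual (f i)) (w i) = xk i := fun i =>
    (H i).gradient_eq_of_max hμ (hxd i) (hmax i)
  let xs : Stack n d := WithLp.toLp 2 fun _ => y
  have hdist := sq_dist_gradient_le H hμ (xs := xs) hw.2 hws hval hxk hy fun i j => rfl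
  have hws' : ws ∈ sublevel f w0 := ⟨hval ▸ hmin _ hw0, hws⟩
  have hw0' : w0 ∈ sublevel f w0 := ⟨le_rfl, hw0⟩
  have hbdd := (isCompact_sublevel H hμ hconv hint w0).isBounded
  have hnorm : ∀ v ∈ sublevel f w0, ‖v‖ ≤ radius f w0 + ‖w0‖ := by
    intro v hv
    have h1 := Metric.dist_le_diam_of_mem hbdd hv hw0'
    rw [dist_eq_norm] at h1
    have h2 := norm_le_norm_sub_add v w0
    unfold radius
    linarith
  have horth : ∀ v ∈ dualFeasible n d, ⟪v, xk⟫_ℝ = ⟪v, xk - xs⟫_ℝ := by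
    intro v hv
    have : ⟪v, xs⟫_ℝ = 0 := by
      rw [PiLp.inner_apply]
      change ∑ i, ⟪v i, y⟫_ℝ = 0
      rw [← sum_inner, (show ∑ i, v i = 0 from hv), inner_zero_left]
    rw [inner_sub_right, this, sub_zero]
  have hcs : ∀ v ∈ sublevel f w0, |⟪v, xk⟫_ℝ| ≤ (radius f w0 + ‖w0‖) *
      Real.sqrt (2 * (1 / μ) * (dualObj f w - dualValue f)) := by
    intro v hv
    rw [horth v hv.2]
    exact (abs_real_inner_le_norm _ _).trans
      (mul_le_mul (hnorm v hv) hdist (norm_nonneg _) ((norm_nonneg v).trans (hnorm v hv)))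
  have hF : (primalObj f xk).toReal = ⟪w, xk⟫_ℝ - dualObj f w := by
    rw [primalObj_eq_coe hbot hxd, EReal.toReal_coe, dualObj, PiLp.inner_apply,
      ← Finset.sum_sub_distrib]
    exact Finset.sum_congr rfl fun i _ => by rw [hmax i]; ring
  have hlow : dualObj f w + ⟪ws, xk⟫_ℝ - ⟪w, xk⟫_ℝ ≤ dualValue f := by
    have h1 : ∑ i, (dual (f i) (w i) + ⟪xk i, ws i - w i⟫_ℝ) ≤ dualObj f ws :=
      Finset.sum_le_sum fun i _ => by
        have := (H i).convex_lower hμ (w i) (ws i)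
        rwa [hxk] at this
    rw [Finset.sum_add_distrib] at h1
    rw [← hval, PiLp.inner_apply, PiLp.inner_apply, add_sub_assoc, ← Finset.sum_sub_distrib]
    refine le_trans (le_of_eq ?_) h1
    rw [dualObj]
    congr 1
    refine Finset.sum_congr rfl fun i _ => ?_
    rw [← inner_sub_left, real_inner_comm]
  rw [strong_duality H hbot hμ hn hconv hint, EReal.toReal_coe, hF]
  have ha := abs_le.1 (hcs w hw)
  have hb := abs_le.1 (hcs ws hws')
  have hc := hmin w hw.2
  rw [abs_le]
  constructor <;> linarith [ha.1, ha.2, hb.1, hb.2]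

end Duality

/-! ### Spectral gap of the graph Laplacian -/

section Laplacian

variable {n d : ℕ}

open Classical in
lemma hasEigenvalue_eigenvalues (G : SimpleGraph (Fin n)) (i : Fin n) :
    Module.End.HasEigenvalue (Matrix.toLin' (G.lapMatrix ℝ))
      ((G.isHermitian_lapMatrix ℝ).eigenvalues i) := by
  refine Module.End.hasEigenvalue_of_hasEigenvector
    (x := ((G.isHermitian_lapMatrix ℝ).eigenvectorBasis i).ofLp) ⟨?_, ?_⟩
  · rw [Module.End.mem_eigenspace_iff, Matrix.toLin'_apply, Matrix.IsHermitian.mulVec_eigenvectorBasis]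
  · intro h0
    have := (G.isHermitian_lapMatrix ℝ).eigenvectorBasis.orthonormal.ne_zero i
    exact this (by ext j; exact congrFun h0 j)

open Classical in
lemma lapMatrix_dotProduct (G : SimpleGraph (Fin n)) (v : Fin n → ℝ) :
    v ⬝ᵥ (G.lapMatrix ℝ).mulVec v = (∑ i, ∑ j ∈ nbrs G i, (v i - v j) ^ 2) / 2 := by
  have := SimpleGraph.lapMatrix_toLinearMap₂' (R := ℝ) G v
  rw [Matrix.toLinearMap₂'_apply'] at this
  rw [this]
  simp only [nbrs, Finset.sum_filter]

open Classical in
lemma nonneg_of_lapMatrix_hasEigenvalue (G : SimpleGraph (Fin n)) {r : ℝ}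
    (hr : Module.End.HasEigenvalue (Matrix.toLin' (G.lapMatrix ℝ)) r) : 0 ≤ r := by
  obtain ⟨v, hv⟩ := hr.exists_hasEigenvector
  have h1 := hv.apply_eq_smul
  rw [Matrix.toLin'_apply] at h1
  have h2 := lapMatrix_dotProduct G v
  rw [h1, dotProduct_smul, smul_eq_mul] at h2
  have h3 : 0 ≤ r * (v ⬝ᵥ v) := by
    rw [h2]
    exact div_nonneg (Finset.sum_nonneg fun i _ => Finset.sum_nonneg fun j _ => sq_nonneg _)
      zero_le_two
  have h4 : 0 < v ⬝ᵥ v := by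
    rcases (Finset.sum_nonneg fun i _ => mul_self_nonneg (v i) : 0 ≤ v ⬝ᵥ v).eq_or_lt with h | h
    · exact absurd (dotProduct_self_eq_zero.1 h.symm) hv.2
    · exact h
  exact nonneg_of_mul_nonneg_left h3 h4

/-- Expand `v` in an eigenbasis. On a connected graph, eigenvectors for `0` are constant, hence
orthogonal to `v`; every other eigenvalue is at least `lapMin G`. -/
lemma lapMin_mul_sum_sq_le {G : SimpleGraph (Fin n)} (hG : G.Connected) (v : Fin n → ℝ)
    (hv : ∑ i, v i = 0) :
    lapMin G * ∑ i, v i ^ 2 ≤ (∑ i, ∑ j ∈ nbrs G i, (v i - v j) ^ 2) / 2 := by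
  classical
  rw [← lapMatrix_dotProduct]
  have hA := G.isHermitian_lapMatrix ℝ
  set e := hA.eigenvectorBasis with he
  set V : EuclideanSpace ℝ (Fin n) := WithLp.toLp 2 v with hV
  set AV : EuclideanSpace ℝ (Fin n) := WithLp.toLp 2 ((G.lapMatrix ℝ).mulVec v) with hAV
  have hinner : ∀ i, ⟪e i, AV⟫_ℝ = hA.eigenvalues i * ⟪e i, V⟫_ℝ := by
    intro i
    have h1 : ∀ a b : EuclideanSpace ℝ (Fin n), ⟪a, b⟫_ℝ = a.ofLp ⬝ᵥ b.ofLp := fun a b => by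
      rw [real_inner_comm]; rfl
    rw [h1, h1]
    change (e i).ofLp ⬝ᵥ (G.lapMatrix ℝ).mulVec v = _ * ((e i).ofLp ⬝ᵥ v)
    rw [Matrix.dotProduct_mulVec, ← Matrix.mulVec_transpose, (G.isSymm_lapMatrix (R := ℝ)).eq,
      he, hA.mulVec_eigenvectorBasis, smul_dotProduct, smul_eq_mul]
  have hquad : v ⬝ᵥ (G.lapMatrix ℝ).mulVec v = ∑ i, hA.eigenvalues i * ⟪e i, V⟫_ℝ ^ 2 := by
    have h1 : v ⬝ᵥ (G.lapMatrix ℝ).mulVec v = ⟪V, AV⟫_ℝ := by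
      rw [real_inner_comm]; rfl
    rw [h1, ← e.sum_inner_mul_inner]
    refine Finset.sum_congr rfl fun i _ => ?_
    rw [hinner, real_inner_comm]
    ring
  have hnorm : ∑ i, v i ^ 2 = ∑ i, ⟪e i, V⟫_ℝ ^ 2 := by
    have h1 := e.sum_sq_norm_inner_right V
    rw [EuclideanSpace.norm_sq_eq] at h1
    simpa using h1.symm
  rw [hnorm, hquad, Finset.mul_sum]
  refine Finset.sum_le_sum fun i _ => ?_
  by_cases h0 : hA.eigenvalues i = 0
  · have hker : (G.lapMatrix ℝ).mulVec (e i).ofLp = 0 := by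
      rw [he, hA.mulVec_eigenvectorBasis, h0, zero_smul]
    have hconst := (SimpleGraph.lapMatrix_mulVec_eq_zero_iff_forall_reachable G).1 hker
    have : ⟪e i, V⟫_ℝ = 0 := by
      obtain ⟨j⟩ := hG.nonempty
      have h1 : ⟪e i, V⟫_ℝ = ∑ l, v l * (e i).ofLp l := rfl
      rw [h1, Finset.sum_congr rfl fun l _ => by rw [hconst l j (hG.preconnected l j)],
        ← Finset.sum_mul, hv, zero_mul]
    simp [this]
  · refine mul_le_mul_of_nonneg_right ?_ (sq_nonneg _)
    exact csInf_le ⟨0, fun r hr => nonneg_of_lapMatrix_hasEigenvalue G hr.2⟩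
      ⟨h0, hasEigenvalue_eigenvalues G i⟩

/-- Two nodes are needed so that a nonzero eigenvalue exists: a zero Laplacian would have the
injective function `i ↦ i` in its kernel, which holds only constants. -/
lemma lapMin_pos {G : SimpleGraph (Fin n)} (hG : G.Connected) (hn : 2 ≤ n) : 0 < lapMin G := by
  classical
  set s : Set ℝ := {r | r ≠ 0 ∧ Module.End.HasEigenvalue (Matrix.toLin' (G.lapMatrix ℝ)) r}
  have hfin : s.Finite := (Module.End.finite_hasEigenvalue _).subset fun r hr => hr.2
  have hne : s.Nonempty := by
    by_contra hempty
    have h0 : (G.isHermitian_lapMatrix ℝ).eigenvalues = 0 := by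
      funext i
      by_contra hi
      exact hempty ⟨_, hi, hasEigenvalue_eigenvalues G i⟩
    rw [Matrix.IsHermitian.eigenvalues_eq_zero_iff] at h0
    have hconst := (SimpleGraph.lapMatrix_mulVec_eq_zero_iff_forall_reachable G
      (x := fun i : Fin n => (i : ℝ))).1 (by rw [h0, Matrix.zero_mulVec])
    have := hconst ⟨0, by omega⟩ ⟨1, by omega⟩ (hG.preconnected _ _)
    simp at this
  have hmem : lapMin G ∈ s := hne.csInf_mem hfin
  exact lt_of_le_of_ne (nonneg_of_lapMatrix_hasEigenvalue G hmem.2) hmem.1.symm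

/-- Only finitely many graphs exist on `Fin n`, so the infimum over all times is attained. -/
lemma lapInf_pos {G : ℕ → SimpleGraph (Fin n)} {B : ℕ}
    (hconn : ∀ k, (unionGraph G B k).Connected) (hn : 2 ≤ n) : 0 < lapInf G B := by
  have hfin : (Set.range fun t : ℕ => lapMin (unionGraph G B (t * B))).Finite :=
    (Set.finite_range (lapMin (n := n))).subset (by rintro _ ⟨t, rfl⟩; exact ⟨_, rfl⟩)
  obtain ⟨t, ht⟩ := (Set.range_nonempty _).csInf_mem hfin
  rw [lapInf, iInf, ← ht]
  exact lapMin_pos (hconn _) hn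

lemma lapInf_le {G : ℕ → SimpleGraph (Fin n)} {B : ℕ} (t : ℕ) :
    lapInf G B ≤ lapMin (unionGraph G B (t * B)) := by
  refine ciInf_le ?_ t
  exact ((Set.finite_range (lapMin (n := n))).subset
    (by rintro _ ⟨t, rfl⟩; exact ⟨_, rfl⟩)).bddBelow

/-- The spectral gap for vector-valued functions on the nodes. -/
lemma lapMin_mul_sum_norm_sq_le {G : SimpleGraph (Fin n)} (hG : G.Connected) (g : Fin n → Vec d)
    (hg : ∑ i, g i = 0) :
    lapMin G * ∑ i, ‖g i‖ ^ 2 ≤ (∑ i, ∑ j ∈ nbrs G i, ‖g i - g j‖ ^ 2) / 2 := by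
  have h1 : ∀ a : Fin d, lapMin G * ∑ i, g i a ^ 2 ≤
      (∑ i, ∑ j ∈ nbrs G i, (g i a - g j a) ^ 2) / 2 := fun a => by
    refine lapMin_mul_sum_sq_le hG (fun i => g i a) ?_
    have := congrArg (fun u : Vec d => u a) hg
    simpa using this
  have h2 := Finset.sum_le_sum fun a (_ : a ∈ Finset.univ) => h1 a
  rw [← Finset.mul_sum, ← Finset.sum_div, Finset.sum_comm,
    Finset.sum_comm (s := (Finset.univ : Finset (Fin d)))] at h2
  simp only [Finset.sum_comm (s := (Finset.univ : Finset (Fin d)))] at h2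
  simpa [EuclideanSpace.norm_sq_eq] using h2

end Laplacian

/-! ### Descent of the dual objective -/

section Descent

variable {n d : ℕ} {f : Fin n → Vec d → EReal}

lemma mem_nbrs {G : SimpleGraph (Fin n)} {i j : Fin n} : j ∈ nbrs G i ↔ G.Adj i j := by
  simp [nbrs]

lemma sum_nbrs_comm {M : Type*} [AddCommMonoid M] (G : SimpleGraph (Fin n))
    (a : Fin n → Fin n → M) :
    ∑ i, ∑ j ∈ nbrs G i, a i j = ∑ i, ∑ j ∈ nbrs G i, a j i := by
  classical
  simp only [nbrs, Finset.sum_filter]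
  rw [Finset.sum_comm]
  simp only [G.adj_comm]

lemma history_comm (G : ℕ → SimpleGraph (Fin n)) (m k : ℕ) (i j : Fin n) :
    history G m k i j = history G m k j i := by
  classical
  have h : (fun t => (G t).Adj i j) = fun t => (G t).Adj j i :=
    funext fun t => propext ((G t).adj_comm i j)
  exact congrArg (fun P : ℕ → Prop => (Finset.range (k + 1)).filter fun t =>
    P t ∧ ((Finset.range (k + 1)).filter fun s => t < s ∧ P s).card < m) h

/-- Both endpoints of an edge take the same branch of `halfStep`. -/
lemma safeGuard_comm (w : ℕ → Stack n d) (L c₁ c₂ : ℝ) (k : ℕ) (i j : Fin n) (u v : Vec d) :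
    SafeGuard f w L c₁ c₂ k i j u v ↔ SafeGuard f w L c₁ c₂ k j i v u := by
  unfold SafeGuard
  rw [norm_sub_rev (dualGrad f w k i), add_comm (‖u - w k i‖ ^ 2)]
  constructor <;> intro h <;> linarith

/-- The linear-plus-quadratic model of the change of `d_i` when `w_i^k` is replaced by `u`. -/
def model (f : Fin n → Vec d → EReal) (w : ℕ → Stack n d) (L : ℝ) (k : ℕ) (i : Fin n)
    (u : Vec d) : ℝ :=
  ⟪dualGrad f w k i, u - w k i⟫_ℝ + L / 2 * ‖u - w k i‖ ^ 2

lemma candidate_add_candidate {w : ℕ → Stack n d} {I : Finset ℕ} {k : ℕ} {i j : Fin n}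
    {a b : ℕ → ℝ} (hab : CoeffFeasible w I k i j a b) (β : ℝ) :
    candidate f w β I i j a b + candidate f w β I j i b a = w k i + w k j := by
  rw [← hab.1, candidate, candidate, smul_sub, smul_sub]
  abel

lemma plainStep_add_plainStep (w : ℕ → Stack n d) (β : ℝ) (k : ℕ) (i j : Fin n) :
    plainStep f w β k i j + plainStep f w β k j i = w k i + w k j := by
  rw [plainStep, plainStep, smul_sub, smul_sub]
  abel

/-- The `β`-corrections at the two endpoints are opposite; for the candidates, the coupling
constraint does the rest. -/
lemma halfStep_add_halfStep {w : ℕ → Stack n d} {I : Finset ℕ} {k : ℕ} {i j : Fin n}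
    {a b : ℕ → ℝ} (hab : CoeffFeasible w I k i j a b) (β L c₁ c₂ : ℝ) :
    halfStep f w β L c₁ c₂ I k i j a b + halfStep f w β L c₁ c₂ I k j i b a =
      w k i + w k j := by
  unfold halfStep
  rw [safeGuard_comm (f := f) w L c₁ c₂ k j i]
  split_ifs
  · exact candidate_add_candidate hab β
  · exact plainStep_add_plainStep w β k i j

/-- An accepted candidate satisfies this by the safe-guard. For the plain step the model changes by
exactly `-β(1 - βL)‖δ‖²` and the squared step lengths add up to `2β²‖δ‖²`; the ratio is the `(1/β -
L)/2` in `theta₂`. -/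
lemma model_halfStep_le (w : ℕ → Stack n d) {β L c₁ c₂ : ℝ} (hβ : 0 < β) (I : Finset ℕ) (k : ℕ)
    (i j : Fin n) (a b : ℕ → ℝ) {u v : Vec d} (hu : u = halfStep f w β L c₁ c₂ I k i j a b)
    (hv : v = halfStep f w β L c₁ c₂ I k j i b a) :
    model f w L k i u + model f w L k j v ≤
        -theta₁ β L c₁ * ‖dualGrad f w k i - dualGrad f w k j‖ ^ 2 ∧
      model f w L k i u + model f w L k j v ≤
        -theta₂ β L c₂ * (‖u - w k i‖ ^ 2 + ‖v - w k j‖ ^ 2) := by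
  have ht₁ : theta₁ β L c₁ ≤ β * (1 - β * L) ∧ theta₁ β L c₁ ≤ c₁ :=
    ⟨min_le_left _ _, min_le_right _ _⟩
  have ht₂ : theta₂ β L c₂ ≤ (1 / β - L) / 2 ∧ theta₂ β L c₂ ≤ c₂ :=
    ⟨min_le_left _ _, min_le_right _ _⟩
  have hs₁ : 0 ≤ ‖dualGrad f w k i - dualGrad f w k j‖ ^ 2 := by positivity
  have hs₂ : 0 ≤ ‖u - w k i‖ ^ 2 + ‖v - w k j‖ ^ 2 := by positivity
  unfold halfStep at hu hv
  rw [safeGuard_comm (f := f) w L c₁ c₂ k j i] at hv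
  split_ifs at hu hv with hsg
  · rw [← hu, ← hv] at hsg
    obtain ⟨h1, h2⟩ := le_min_iff.1 hsg
    rw [add_assoc] at h1 h2
    change model f w L k i u + model f w L k j v ≤ _ at h1
    change model f w L k i u + model f w L k j v ≤ _ at h2
    exact ⟨by nlinarith [mul_le_mul_of_nonneg_right ht₁.2 hs₁],
      by nlinarith [mul_le_mul_of_nonneg_right ht₂.2 hs₂]⟩
  · set δ := dualGrad f w k i - dualGrad f w k j with hδ
    have hu' : u - w k i = -(β • δ) := by rw [hu, plainStep]; abel
    have hv' : v - w k j = β • δ := by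
      rw [hv, plainStep, hδ, ← neg_sub (dualGrad f w k i), smul_neg]; abel
    have hinner : ⟪dualGrad f w k i, δ⟫_ℝ - ⟪dualGrad f w k j, δ⟫_ℝ = ‖δ‖ ^ 2 := by
      rw [← inner_sub_left, ← hδ, real_inner_self_eq_norm_sq]
    have hmodel : model f w L k i u + model f w L k j v = -(β * (1 - β * L)) * ‖δ‖ ^ 2 := by
      unfold model
      rw [hu', hv', inner_neg_right, inner_smul_right, inner_smul_right, norm_neg, norm_smul,
        mul_pow, Real.norm_eq_abs, sq_abs]
      linear_combination (-β) * hinner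
    have hnorm : ‖u - w k i‖ ^ 2 + ‖v - w k j‖ ^ 2 = 2 * β ^ 2 * ‖δ‖ ^ 2 := by
      rw [hu', hv', norm_neg, norm_smul, mul_pow, Real.norm_eq_abs, sq_abs]
      ring
    rw [hnorm] at hs₂ ⊢
    rw [hmodel]
    refine ⟨by nlinarith [mul_le_mul_of_nonneg_right ht₁.1 hs₁], ?_⟩
    have h1 := mul_le_mul_of_nonneg_right ht₂.1 hs₂
    have h2 : (1 / β - L) / 2 * (2 * β ^ 2 * ‖δ‖ ^ 2) = β * (1 - β * L) * ‖δ‖ ^ 2 := by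
      field_simp
    linarith

lemma norm_sq_sum_smul_le {ι : Type*} (s : Finset ι) (h : ι → ℝ) (hh : ∀ j ∈ s, 0 ≤ h j)
    (hs : ∑ j ∈ s, h j ≤ 1) (e : ι → Vec d) :
    ‖∑ j ∈ s, h j • e j‖ ^ 2 ≤ ∑ j ∈ s, h j * ‖e j‖ ^ 2 := by
  have h1 : ‖∑ j ∈ s, h j • e j‖ ≤ ∑ j ∈ s, h j * ‖e j‖ := by
    refine (norm_sum_le _ _).trans (Finset.sum_le_sum fun j hj => ?_)
    rw [norm_smul, Real.norm_of_nonneg (hh j hj)]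
  have h2 : (∑ j ∈ s, h j * ‖e j‖) ^ 2 ≤ (∑ j ∈ s, h j) * ∑ j ∈ s, h j * ‖e j‖ ^ 2 :=
    Finset.sum_sq_le_sum_mul_sum_of_sq_le_mul s hh
      (fun j hj => mul_nonneg (hh j hj) (sq_nonneg _)) fun j _ => le_of_eq (by ring)
  have h3 : 0 ≤ ∑ j ∈ s, h j * ‖e j‖ ^ 2 :=
    Finset.sum_nonneg fun j hj => mul_nonneg (hh j hj) (sq_nonneg _)
  calc ‖∑ j ∈ s, h j • e j‖ ^ 2 ≤ (∑ j ∈ s, h j * ‖e j‖) ^ 2 := by gcongr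
    _ ≤ (∑ j ∈ s, h j) * ∑ j ∈ s, h j * ‖e j‖ ^ 2 := h2
    _ ≤ _ := mul_le_of_le_one_left h3 hs

section Step

variable {μ L : ℝ}
  (H : ∀ i, ConjFacts (dom (f i)) (fun x => (f i x).toReal) μ (dual (f i)))
  {G : SimpleGraph (Fin n)} {h : Fin n → Fin n → ℝ} {w : ℕ → Stack n d} {k : ℕ}
  {u : Fin n → Fin n → Vec d}

include H in
lemma dualObj_step_le (hμ : 0 < μ) (hL : L = 1 / μ) (hnonneg : ∀ i j, G.Adj i j → 0 ≤ h i j)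
    (hsum : ∀ i, ∑ j ∈ nbrs G i, h i j ≤ 1)
    (hw : ∀ i, w (k + 1) i = (1 - ∑ j ∈ nbrs G i, h i j) • w k i + ∑ j ∈ nbrs G i, h i j • u i j) :
    dualObj f (w (k + 1)) ≤ dualObj f (w k) +
      ∑ i, ∑ j ∈ nbrs G i, h i j * model f w L k i (u i j) := by
  rw [dualObj, dualObj, ← Finset.sum_add_distrib]
  refine Finset.sum_le_sum fun i _ => ?_
  rw [hw i]
  refine ((H i).jensen hμ _ _ (fun j hj => hnonneg i j (mem_nbrs.1 hj)) (hsum i) _ _).trans ?_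
  have : ∑ j ∈ nbrs G i, h i j * dual (f i) (u i j) ≤
      ∑ j ∈ nbrs G i, h i j * (dual (f i) (w k i) + model f w L k i (u i j)) := by
    refine Finset.sum_le_sum fun j hj =>
      mul_le_mul_of_nonneg_left ?_ (hnonneg i j (mem_nbrs.1 hj))
    have h1 := (H i).smooth (w k i) (u i j)
    have h2 : L / 2 = 1 / (2 * μ) := by rw [hL]; field_simp
    rw [model, dualGrad, h2]
    linarith
  simp only [mul_add, Finset.sum_add_distrib, ← Finset.sum_mul] at this
  linarith

/-- Pairs the two orientations of each edge, since the model estimates hold for pairs only. -/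
lemma sum_model_symm (hsymm : ∀ i j, G.Adj i j → h i j = h j i) (q : Fin n → Fin n → ℝ) :
    ∑ i, ∑ j ∈ nbrs G i, h i j * q i j =
      (∑ i, ∑ j ∈ nbrs G i, h i j * (q i j + q j i)) / 2 := by
  have h1 := sum_nbrs_comm G fun i j => h i j * q i j
  have h2 : ∑ i, ∑ j ∈ nbrs G i, h j i * q j i = ∑ i, ∑ j ∈ nbrs G i, h i j * q j i :=
    Finset.sum_congr rfl fun i _ => Finset.sum_congr rfl fun j hj => by
      rw [hsymm i j (mem_nbrs.1 hj)]
  simp only [mul_add, Finset.sum_add_distrib]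
  linarith

include H in
/-- One step decreases the dual objective in terms of the disagreement of the gradients and in
terms of the length of the step. -/
lemma descent_step (hμ : 0 < μ) (hL : L = 1 / μ) {c θ₁ θ₂ : ℝ} (hc : 0 ≤ c)
    (hθ₁ : 0 ≤ θ₁) (hθ₂ : 0 ≤ θ₂) (hge : ∀ i j, G.Adj i j → c ≤ h i j)
    (hsymm : ∀ i j, G.Adj i j → h i j = h j i) (hsum : ∀ i, ∑ j ∈ nbrs G i, h i j ≤ 1)
    (hw : ∀ i, w (k + 1) i = (1 - ∑ j ∈ nbrs G i, h i j) • w k i + ∑ j ∈ nbrs G i, h i j • u i j)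
    (hpair : ∀ i j, G.Adj i j →
      model f w L k i (u i j) + model f w L k j (u j i) ≤
        -θ₁ * ‖dualGrad f w k i - dualGrad f w k j‖ ^ 2 ∧
      model f w L k i (u i j) + model f w L k j (u j i) ≤
        -θ₂ * (‖u i j - w k i‖ ^ 2 + ‖u j i - w k j‖ ^ 2)) :
    c * θ₁ * ((∑ i, ∑ j ∈ nbrs G i, ‖dualGrad f w k i - dualGrad f w k j‖ ^ 2) / 2) ≤
        dualObj f (w k) - dualObj f (w (k + 1)) ∧
      θ₂ * ∑ i, ‖w (k + 1) i - w k i‖ ^ 2 ≤ dualObj f (w k) - dualObj f (w (k + 1)) := by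
  have hnonneg : ∀ i j, G.Adj i j → 0 ≤ h i j := fun i j hij => hc.trans (hge i j hij)
  have hstep := dualObj_step_le H hμ hL hnonneg hsum hw
  rw [sum_model_symm hsymm fun i j => model f w L k i (u i j)] at hstep
  constructor
  · have h1 : ∑ i, ∑ j ∈ nbrs G i, h i j * (model f w L k i (u i j) + model f w L k j (u j i)) ≤
        ∑ i, ∑ j ∈ nbrs G i, -(c * θ₁) * ‖dualGrad f w k i - dualGrad f w k j‖ ^ 2 := by
      refine Finset.sum_le_sum fun i _ => Finset.sum_le_sum fun j hj => ?_
      have hij := mem_nbrs.1 hj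
      have h2 := mul_le_mul_of_nonneg_left (hpair i j hij).1 (hnonneg i j hij)
      have h3 := mul_le_mul_of_nonneg_right (hge i j hij)
        (by positivity : 0 ≤ θ₁ * ‖dualGrad f w k i - dualGrad f w k j‖ ^ 2)
      linarith
    simp only [← Finset.mul_sum] at h1
    linarith
  · have h1 : ∑ i, ∑ j ∈ nbrs G i, h i j * (model f w L k i (u i j) + model f w L k j (u j i)) ≤
        -θ₂ * ∑ i, ∑ j ∈ nbrs G i, h i j * (‖u i j - w k i‖ ^ 2 + ‖u j i - w k j‖ ^ 2) := by
      simp only [Finset.mul_sum]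
      refine Finset.sum_le_sum fun i _ => Finset.sum_le_sum fun j hj => ?_
      have hij := mem_nbrs.1 hj
      have h2 := mul_le_mul_of_nonneg_left (hpair i j hij).2 (hnonneg i j hij)
      linarith
    have h2 := sum_model_symm hsymm fun i j => ‖u i j - w k i‖ ^ 2
    have h3 : ∑ i, ‖w (k + 1) i - w k i‖ ^ 2 ≤
        ∑ i, ∑ j ∈ nbrs G i, h i j * ‖u i j - w k i‖ ^ 2 := by
      refine Finset.sum_le_sum fun i _ => ?_
      have h4 : w (k + 1) i - w k i = ∑ j ∈ nbrs G i, h i j • (u i j - w k i) := by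
        rw [hw i]
        simp only [smul_sub, Finset.sum_sub_distrib, sub_smul, one_smul, ← Finset.sum_smul]
        abel
      rw [h4]
      exact norm_sq_sum_smul_le _ _ (fun j hj => hnonneg i j (mem_nbrs.1 hj)) (hsum i) _
    have h5 := mul_le_mul_of_nonneg_left h3 hθ₂
    simp only [h2] at h5
    linarith

/-- Exchanging the endpoints negates the transfer along an edge, so the total transfer equals its
own negative. -/
lemma sum_step (hsymm : ∀ i j, G.Adj i j → h i j = h j i)
    (hw : ∀ i, w (k + 1) i = (1 - ∑ j ∈ nbrs G i, h i j) • w k i + ∑ j ∈ nbrs G i, h i j • u i j)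
    (hadd : ∀ i j, G.Adj i j → u i j + u j i = w k i + w k j) :
    ∑ i, w (k + 1) i = ∑ i, w k i := by
  have h0 : ∀ i, w (k + 1) i = w k i + ∑ j ∈ nbrs G i, h i j • (u i j - w k i) := by
    intro i
    rw [hw i]
    simp only [smul_sub, Finset.sum_sub_distrib, sub_smul, one_smul, ← Finset.sum_smul]
    abel
  simp only [h0, Finset.sum_add_distrib]
  set X := ∑ i, ∑ j ∈ nbrs G i, h i j • (u i j - w k i) with hX
  have h1 : X = -X := by
    conv_lhs => rw [hX, sum_nbrs_comm]
    rw [hX, ← Finset.sum_neg_distrib]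
    refine Finset.sum_congr rfl fun i _ => ?_
    rw [← Finset.sum_neg_distrib]
    refine Finset.sum_congr rfl fun j hj => ?_
    have hij := mem_nbrs.1 hj
    rw [← hsymm i j hij, ← smul_neg]
    congr 1
    rw [neg_sub, sub_eq_sub_iff_add_eq_add, add_comm, hadd i j hij]
  have h2 : (2 : ℝ) • X = 0 := by rw [two_smul]; exact add_eq_zero_iff_eq_neg.2 h1
  rw [(smul_eq_zero.1 h2).resolve_left two_ne_zero, add_zero]

end Step

/-- Per-step guarantees of a run. -/
lemma IsRun.step_facts {μ L β c₁ c₂ : ℝ} {m : ℕ} {G : ℕ → SimpleGraph (Fin n)}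
    {h : ℕ → Fin n → Fin n → ℝ} {w x : ℕ → Stack n d}
    (hrun : IsRun f G h β L c₁ c₂ m w x)
    (H : ∀ i, ConjFacts (dom (f i)) (fun x => (f i x).toReal) μ (dual (f i)))
    (hμ : 0 < μ) (hL : L = 1 / μ) (hβ : 0 < β) {c : ℝ} (hc : 0 ≤ c)
    (hθ₁ : 0 ≤ theta₁ β L c₁) (hθ₂ : 0 ≤ theta₂ β L c₂)
    (hge : ∀ k i j, (G k).Adj i j → c ≤ h k i j)
    (hsymm : ∀ k i j, (G k).Adj i j → h k i j = h k j i)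
    (hsum : ∀ k i, ∑ j ∈ nbrs (G k) i, h k i j ≤ 1) (k : ℕ) :
    ∑ i, w (k + 1) i = ∑ i, w k i ∧
      c * theta₁ β L c₁ *
          ((∑ i, ∑ j ∈ nbrs (G k) i, ‖dualGrad f w k i - dualGrad f w k j‖ ^ 2) / 2) ≤
        dualObj f (w k) - dualObj f (w (k + 1)) ∧
      theta₂ β L c₂ * ∑ i, ‖w (k + 1) i - w k i‖ ^ 2 ≤
        dualObj f (w k) - dualObj f (w (k + 1)) := by
  obtain ⟨α, hα, hw⟩ := hrun.step
  refine ⟨sum_step (hsymm k) (hw k) fun i j hij => ?_,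
    descent_step H hμ hL hc hθ₁ hθ₂ (hge k) (hsymm k) (hsum k) (hw k) fun i j hij => ?_⟩
  · rw [history_comm G m k j i]
    exact halfStep_add_halfStep (hα k i j hij).1 β L c₁ c₂
  · exact model_halfStep_le w hβ (history G m k i j) k i j (α k i j) (α k j i) rfl
      (by rw [history_comm G m k j i])

end Descent

/-! ### Convergence rate -/

section Rate

open Filter Topology

variable {n d : ℕ} {f : Fin n → Vec d → EReal}

lemma unionGraph_adj {G : ℕ → SimpleGraph (Fin n)} {B K : ℕ} {i j : Fin n} :
    (unionGraph G B K).Adj i j ↔ ∃ s < B, (G (K + s)).Adj i j := by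
  simp only [unionGraph, SimpleGraph.iSup_adj, Set.mem_Ico]
  constructor
  · rintro ⟨t, ⟨h1, h2⟩, h3⟩
    exact ⟨t - K, by omega, by rwa [Nat.add_sub_cancel' h1]⟩
  · rintro ⟨s, hs, h⟩
    exact ⟨K + s, ⟨by omega, by omega⟩, h⟩

lemma card_nbrs_le_degMax (G : ℕ → SimpleGraph (Fin n)) (B t : ℕ) (i : Fin n) :
    (nbrs (unionGraph G B (t * B)) i).card ≤ degMax G B := by
  classical
  have hbdd : BddAbove (Set.range fun t : ℕ => (unionGraph G B (t * B)).maxDegree) :=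
    ((Set.finite_range fun G : SimpleGraph (Fin n) => G.maxDegree).subset
      (by rintro _ ⟨t, rfl⟩; exact ⟨_, rfl⟩)).bddAbove
  have h1 : (nbrs (unionGraph G B (t * B)) i).card = (unionGraph G B (t * B)).degree i := by
    rw [← SimpleGraph.card_neighborFinset_eq_degree]
    congr 1
    ext j
    simp [mem_nbrs]
  rw [h1]
  refine ((unionGraph G B (t * B)).degree_le_maxDegree i).trans ?_
  refine le_trans (le_of_eq ?_) (le_ciSup hbdd t)
  congr

lemma norm_sub_sq_le_three (a b a' b' : Vec d) :
    ‖a - b‖ ^ 2 ≤ 3 * (‖a' - a‖ ^ 2 + ‖a' - b'‖ ^ 2 + ‖b' - b‖ ^ 2) := by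
  have h1 : ‖a - b‖ ≤ ‖a' - a‖ + ‖a' - b'‖ + ‖b' - b‖ := by
    have : a - b = (a - a') + (a' - b') + (b' - b) := by abel
    rw [this, norm_sub_rev a' a]
    exact norm_add₃_le
  have h2 : ‖a - b‖ ^ 2 ≤ (‖a' - a‖ + ‖a' - b'‖ + ‖b' - b‖) ^ 2 := by gcongr
  nlinarith [sq_nonneg (‖a' - a‖ - ‖a' - b'‖), sq_nonneg (‖a' - b'‖ - ‖b' - b‖),
    sq_nonneg (‖a' - a‖ - ‖b' - b‖)]

lemma norm_sq_drift_le (v : ℕ → Vec d) (K B : ℕ) {s : ℕ} (hs : s < B) :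
    ‖v (K + s) - v K‖ ^ 2 ≤ B * ∑ r ∈ Finset.range B, ‖v (K + r + 1) - v (K + r)‖ ^ 2 := by
  have h1 : v (K + s) - v K = ∑ r ∈ Finset.range s, (v (K + r + 1) - v (K + r)) := by
    have := Finset.sum_range_sub (fun r => v (K + r)) s
    simpa [add_assoc] using this.symm
  have h2 : ‖v (K + s) - v K‖ ^ 2 ≤
      (∑ r ∈ Finset.range s, ‖v (K + r + 1) - v (K + r)‖) ^ 2 := by
    rw [h1]
    gcongr
    exact norm_sum_le _ _
  have h3 := sq_sum_le_card_mul_sum_sq (s := Finset.range s)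
    (f := fun r => ‖v (K + r + 1) - v (K + r)‖)
  rw [Finset.card_range] at h3
  refine (h2.trans h3).trans ?_
  gcongr

/-- Over a window of length `B`, the disagreement of the gradients along the union graph is
controlled by the decrease of the dual objective. -/
lemma window_bound {μ L : ℝ} {G : ℕ → SimpleGraph (Fin n)} {B : ℕ} {w : ℕ → Stack n d}
    (H : ∀ i, ConjFacts (dom (f i)) (fun x => (f i x).toReal) μ (dual (f i)))
    (hμ : 0 < μ) (hL : L = 1 / μ) {a b : ℝ} (ha : 0 < a) (hb : 0 < b)
    (hdesc₁ : ∀ k, a * ((∑ i, ∑ j ∈ nbrs (G k) i, ‖dualGrad f w k i - dualGrad f w k j‖ ^ 2) / 2) ≤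
      dualObj f (w k) - dualObj f (w (k + 1)))
    (hdesc₂ : ∀ k, b * ∑ i, ‖w (k + 1) i - w k i‖ ^ 2 ≤ dualObj f (w k) - dualObj f (w (k + 1)))
    (t : ℕ) :
    (∑ i, ∑ j ∈ nbrs (unionGraph G B (t * B)) i,
        ‖dualGrad f w (t * B) i - dualGrad f w (t * B) j‖ ^ 2) / 2 ≤
      (3 * B * L ^ 2 * degMax G B / b + 3 / a) *
        (dualObj f (w (t * B)) - dualObj f (w (t * B + B))) := by
  classical
  set K := t * B with hK
  set U := unionGraph G B K with hU
  set A := dualObj f (w K) - dualObj f (w (K + B)) with hA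
  -- `Z i` is the squared movement of node `i` over the window; `Y i j` is the disagreement on the
  -- edge over its active times.
  set Z : Fin n → ℝ := fun i => ∑ s ∈ Finset.range B, ‖w (K + s + 1) i - w (K + s) i‖ ^ 2 with hZ
  set Y : Fin n → Fin n → ℝ := fun i j => ∑ s ∈ Finset.range B,
    if (G (K + s)).Adj i j then ‖dualGrad f w (K + s) i - dualGrad f w (K + s) j‖ ^ 2 else 0 with hY
  have htel : ∑ s ∈ Finset.range B, (dualObj f (w (K + s)) - dualObj f (w (K + s + 1))) = A := by
    have := Finset.sum_range_sub' (fun s => dualObj f (w (K + s))) B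
    simpa [add_assoc] using this
  have hZsum : b * ∑ i, Z i ≤ A := by
    rw [← htel, hZ, Finset.sum_comm, Finset.mul_sum]
    exact Finset.sum_le_sum fun s _ => hdesc₂ (K + s)
  have hYsum : a * ((∑ i, ∑ j ∈ nbrs U i, Y i j) / 2) ≤ A := by
    have h1 : ∑ i, ∑ j ∈ nbrs U i, Y i j ≤ ∑ i, ∑ j, Y i j := by
      refine Finset.sum_le_sum fun i _ =>
        Finset.sum_le_sum_of_subset_of_nonneg (Finset.subset_univ _) fun j _ _ => ?_
      exact Finset.sum_nonneg fun s _ => by split_ifs <;> positivity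
    have h2 : ∑ i, ∑ j, Y i j = ∑ s ∈ Finset.range B, ∑ i, ∑ j ∈ nbrs (G (K + s)) i,
        ‖dualGrad f w (K + s) i - dualGrad f w (K + s) j‖ ^ 2 := by
      rw [hY, Finset.sum_congr rfl fun i _ => Finset.sum_comm, Finset.sum_comm]
      simp only [nbrs, Finset.sum_filter]
    refine (mul_le_mul_of_nonneg_left (div_le_div_of_nonneg_right (h1.trans h2.le) zero_le_two)
      ha.le).trans ?_
    rw [← htel, Finset.sum_div, Finset.mul_sum]
    exact Finset.sum_le_sum fun s _ => hdesc₁ (K + s)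
  have hLip : ∀ i, ∀ s < B, ‖dualGrad f w (K + s) i - dualGrad f w K i‖ ^ 2 ≤
      L ^ 2 * (B * Z i) := by
    intro i s hs
    have h1 := (H i).gradient_lipschitz hμ (w (K + s) i) (w K i)
    rw [← hL] at h1
    have h2 := norm_sq_drift_le (fun k => w k i) K B hs
    calc ‖dualGrad f w (K + s) i - dualGrad f w K i‖ ^ 2 ≤ (L * ‖w (K + s) i - w K i‖) ^ 2 := by
          gcongr; exact h1
      _ = L ^ 2 * ‖w (K + s) i - w K i‖ ^ 2 := by ring
      _ ≤ _ := by gcongr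
  have hedge : ∀ i, ∀ j ∈ nbrs U i, ‖dualGrad f w K i - dualGrad f w K j‖ ^ 2 ≤
      3 * (L ^ 2 * (B * Z i) + Y i j + L ^ 2 * (B * Z j)) := by
    intro i j hj
    obtain ⟨s, hs, hadj⟩ := unionGraph_adj.1 (mem_nbrs.1 hj)
    refine (norm_sub_sq_le_three _ _ (dualGrad f w (K + s) i) (dualGrad f w (K + s) j)).trans ?_
    have h1 : ‖dualGrad f w (K + s) i - dualGrad f w (K + s) j‖ ^ 2 ≤ Y i j := by
      have := Finset.single_le_sum (f := fun s => if (G (K + s)).Adj i j then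
        ‖dualGrad f w (K + s) i - dualGrad f w (K + s) j‖ ^ 2 else 0)
        (fun s _ => by split_ifs <;> positivity) (Finset.mem_range.2 hs)
      simpa [hadj] using this
    linarith [hLip i s hs, hLip j s hs]
  have hdeg : ∑ i, ∑ j ∈ nbrs U i, Z i ≤ degMax G B * ∑ i, Z i := by
    rw [Finset.mul_sum]
    refine Finset.sum_le_sum fun i _ => ?_
    rw [Finset.sum_const, nsmul_eq_mul]
    refine mul_le_mul_of_nonneg_right ?_ (Finset.sum_nonneg fun s _ => by positivity)
    exact_mod_cast card_nbrs_le_degMax G B t i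
  have hdeg' : ∑ i, ∑ j ∈ nbrs U i, Z j ≤ degMax G B * ∑ i, Z i := by
    rw [← sum_nbrs_comm U fun i _ => Z i]
    exact hdeg
  have htotal : ∑ i, ∑ j ∈ nbrs U i, ‖dualGrad f w K i - dualGrad f w K j‖ ^ 2 ≤
      3 * (L ^ 2 * (B * ∑ i, ∑ j ∈ nbrs U i, Z i) + ∑ i, ∑ j ∈ nbrs U i, Y i j +
        L ^ 2 * (B * ∑ i, ∑ j ∈ nbrs U i, Z j)) := by
    refine (Finset.sum_le_sum fun i _ => Finset.sum_le_sum (hedge i)).trans (le_of_eq ?_)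
    simp only [Finset.mul_sum, mul_add, Finset.sum_add_distrib]
  have hZ' : ∑ i, Z i ≤ A / b := by rw [le_div_iff₀ hb]; linarith
  have hY' : (∑ i, ∑ j ∈ nbrs U i, Y i j) / 2 ≤ A / a := by rw [le_div_iff₀ ha]; linarith
  -- The factor `3` is from the three-term split and `B` from the drift. The `Z i` and `Z j` sums
  -- each carry half a weight and together give one `degMax`.
  have hcoef : 0 ≤ 3 * (B : ℝ) * L ^ 2 := by positivity
  have h1 := mul_le_mul_of_nonneg_left (hdeg.trans
    (mul_le_mul_of_nonneg_left hZ' (Nat.cast_nonneg _))) hcoef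
  have h2 := mul_le_mul_of_nonneg_left (hdeg'.trans
    (mul_le_mul_of_nonneg_left hZ' (Nat.cast_nonneg _))) hcoef
  have h3 : (3 * B * L ^ 2 * degMax G B / b + 3 / a) * A =
      3 * B * L ^ 2 * (degMax G B * (A / b)) + 3 * (A / a) := by ring
  rw [h3]
  linarith

/-- The recursion `λ aₜ² ≤ T (aₜ - aₜ₊₁)` forces a sublinear rate. -/
lemma rate_of_recursion {a : ℕ → ℝ} {lam T : ℝ} (ha : ∀ t, 0 ≤ a t) (hlam : 0 ≤ lam) (hT : 0 < T)
    (hrec : ∀ t, lam * a t ^ 2 ≤ T * (a t - a (t + 1))) (t : ℕ) :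
    a t ≤ T * a 0 / (T + lam * t * a 0) := by
  have hden : ∀ t : ℕ, 0 < T + lam * t * a 0 := fun t => by
    have := mul_nonneg (mul_nonneg hlam (Nat.cast_nonneg t)) (ha 0)
    linarith
  have hmono : ∀ t, a (t + 1) ≤ a t := fun t => by
    have h1 : 0 ≤ T * (a t - a (t + 1)) := le_trans (by positivity) (hrec t)
    linarith [nonneg_of_mul_nonneg_right h1 hT]
  rw [le_div_iff₀ (hden t)]
  induction t with
  | zero => simp [mul_comm]
  | succ t ih =>
    rcases (ha t).eq_or_lt with h0 | h0
    · have : a (t + 1) = 0 := le_antisymm (h0 ▸ hmono t) (ha _)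
      rw [this, zero_mul]
      exact mul_nonneg hT.le (ha 0)
    · refine le_of_mul_le_mul_left ?_ h0
      -- This is `1/aₜ₊₁ ≥ 1/aₜ + lam/T` without denominators.
      have h1 : a (t + 1) * (T + lam * a t) ≤ T * a t := by
        have := mul_le_mul_of_nonneg_left (hmono t) (mul_nonneg hlam h0.le)
        nlinarith [hrec t]
      have h2 := mul_le_mul_of_nonneg_left ih (ha (t + 1))
      have h3 := mul_le_mul_of_nonneg_left h1 (ha 0)
      push_cast
      linarith

/-- Dual suboptimality is bounded by the disagreement of the gradients. -/
lemma sq_dual_gap_le {μ : ℝ}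
    (H : ∀ i, ConjFacts (dom (f i)) (fun x => (f i x).toReal) μ (dual (f i)))
    (hμ : 0 < μ) (hn : 0 < n) {w ws : Stack n d} {R : ℝ} (hw : w ∈ dualFeasible n d)
    (hws : ws ∈ dualFeasible n d) (hle : dualObj f ws ≤ dualObj f w) (hR : ‖w - ws‖ ≤ R)
    {U : SimpleGraph (Fin n)} (hU : U.Connected) (hpos : 0 ≤ lapMin U) :
    lapMin U * (dualObj f w - dualObj f ws) ^ 2 ≤ R ^ 2 *
      ((∑ i, ∑ j ∈ nbrs U i,
        ‖gradient (dual (f i)) (w i) - gradient (dual (f j)) (w j)‖ ^ 2) / 2) := by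
  set g : Fin n → Vec d := fun i => gradient (dual (f i)) (w i) with hg
  set Q := ∑ i, ‖g i - mean g‖ ^ 2 with hQ
  have h1 := lapMin_mul_sum_norm_sq_le hU (fun i => g i - mean g) (sum_sub_mean hn g)
  simp only [sub_sub_sub_cancel_right] at h1
  -- Centring leaves the pairing with `w - ws` unchanged, as that difference sums to zero, and makes
  -- the spectral gap applicable.
  let gs : Stack n d := WithLp.toLp 2 fun i => g i - mean g
  have h2 : dualObj f w - dualObj f ws ≤ ⟪gs, w - ws⟫_ℝ := by
    have h3 : ∑ i, (dual (f i) (w i) + ⟪g i, ws i - w i⟫_ℝ) ≤ dualObj f ws :=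
      Finset.sum_le_sum fun i _ => (H i).convex_lower hμ (w i) (ws i)
    rw [PiLp.inner_apply]
    change _ ≤ ∑ i, ⟪g i - mean g, w i - ws i⟫_ℝ
    rw [sum_inner_sub_const g (fun i => w i - ws i) (mean g) (by
      rw [Finset.sum_sub_distrib, (show ∑ i, w i = 0 from hw), (show ∑ i, ws i = 0 from hws),
        sub_zero])]
    rw [Finset.sum_add_distrib] at h3
    have h4 : ∑ i, ⟪g i, ws i - w i⟫_ℝ = -∑ i, ⟪g i, w i - ws i⟫_ℝ := by
      rw [← Finset.sum_neg_distrib]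
      exact Finset.sum_congr rfl fun i _ => by rw [← inner_neg_right, neg_sub]
    rw [h4] at h3
    change dualObj f w + _ ≤ _ at h3
    linarith
  have h3 : dualObj f w - dualObj f ws ≤ ‖gs‖ * R :=
    h2.trans ((real_inner_le_norm _ _).trans (mul_le_mul_of_nonneg_left hR (norm_nonneg _)))
  have h4 : (dualObj f w - dualObj f ws) ^ 2 ≤ Q * R ^ 2 := by
    have : ‖gs‖ ^ 2 = Q := by rw [PiLp.norm_sq_eq_of_L2]
    rw [← this, ← mul_pow]
    exact pow_le_pow_left₀ (sub_nonneg.2 hle) h3 2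
  calc lapMin U * (dualObj f w - dualObj f ws) ^ 2 ≤ lapMin U * (Q * R ^ 2) := by gcongr
    _ = R ^ 2 * (lapMin U * Q) := by ring
    _ ≤ _ := by gcongr

end Rate

/-! ### Positive constants and the rate along a run -/

section Run

open Filter Topology

variable {n d : ℕ} {f : Fin n → Vec d → EReal}

lemma exists_adj_of_connected_unionGraph {G : ℕ → SimpleGraph (Fin n)} {B K : ℕ}
    (hconn : (unionGraph G B K).Connected) (hn : 2 ≤ n) : ∃ k i j, (G k).Adj i j := by
  classical
  have : Nontrivial (Fin n) := Fin.nontrivial_iff_two_le.2 hn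
  obtain ⟨i⟩ := hconn.nonempty
  obtain ⟨j, hj⟩ := hconn.preconnected.exists_adj_of_nontrivial i
  obtain ⟨s, -, hs⟩ := unionGraph_adj.1 hj
  exact ⟨_, _, _, hs⟩

lemma weightInf_le {G : ℕ → SimpleGraph (Fin n)} {h : ℕ → Fin n → Fin n → ℝ} {c : ℝ}
    (hge : ∀ k i j, (G k).Adj i j → c ≤ h k i j) {k : ℕ} {i j : Fin n} (hij : (G k).Adj i j) :
    weightInf G h ≤ h k i j :=
  csInf_le ⟨c, by rintro _ ⟨k, i, j, hij, rfl⟩; exact hge k i j hij⟩ ⟨k, i, j, hij, rfl⟩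

lemma le_weightInf {G : ℕ → SimpleGraph (Fin n)} {h : ℕ → Fin n → Fin n → ℝ} {c : ℝ}
    (hge : ∀ k i j, (G k).Adj i j → c ≤ h k i j) (hne : ∃ k i j, (G k).Adj i j) :
    c ≤ weightInf G h := by
  obtain ⟨k, i, j, hij⟩ := hne
  refine le_csInf ⟨_, k, i, j, hij, rfl⟩ ?_
  rintro _ ⟨k, i, j, hij, rfl⟩
  exact hge k i j hij

lemma theta₁_pos {β L c₁ : ℝ} (hL : 0 < L) (hβ : β ∈ Set.Ioo 0 (1 / L)) (hc₁ : 0 < c₁) :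
    0 < theta₁ β L c₁ := by
  have : β * L < 1 := (lt_div_iff₀ hL).1 hβ.2
  exact lt_min (mul_pos hβ.1 (by linarith)) hc₁

lemma theta₂_pos {β L c₂ : ℝ} (hL : 0 < L) (hβ : β ∈ Set.Ioo 0 (1 / L)) (hc₂ : 0 < c₂) :
    0 < theta₂ β L c₂ := by
  have : L < 1 / β := (lt_one_div hβ.1 hL).1 hβ.2
  exact lt_min (by linarith) hc₂

/-- With `q = k / B`, the denominator is at least `min T (lam * a) * (q + 1)`, and `k ≤ B (q + 1)`.
-/
lemma window_rate_le_inv {T lam a : ℝ} (hT : 0 < T) (hlam : 0 < lam) (ha : 0 < a) {B : ℕ}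
    (hB : 0 < B) {k : ℕ} (hk : 0 < k) :
    T * a / (T + lam * ((k / B : ℕ) : ℝ) * a) ≤ T * a * B / min T (lam * a) * (1 / (k : ℝ)) := by
  have he : 0 < min T (lam * a) := lt_min hT (mul_pos hlam ha)
  have hkB : (k : ℝ) ≤ B * (((k / B : ℕ) : ℝ) + 1) := by
    exact_mod_cast (Nat.lt_mul_div_succ k hB).le
  have hk' : (0 : ℝ) < k := by exact_mod_cast hk
  have hB' : (0 : ℝ) < B := by exact_mod_cast hB
  have hq : (0 : ℝ) ≤ ((k / B : ℕ) : ℝ) := Nat.cast_nonneg _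
  have hden : min T (lam * a) * k / B ≤ T + lam * ((k / B : ℕ) : ℝ) * a := by
    have h1 : min T (lam * a) * k / B ≤ min T (lam * a) * (((k / B : ℕ) : ℝ) + 1) := by
      rw [div_le_iff₀ hB']
      nlinarith [mul_le_mul_of_nonneg_left hkB he.le]
    have h2 := mul_le_mul_of_nonneg_right (min_le_right T (lam * a)) hq
    linarith [min_le_left T (lam * a)]
  calc T * a / (T + lam * ((k / B : ℕ) : ℝ) * a) ≤ T * a / (min T (lam * a) * k / B) := by
        gcongr
    _ = _ := by field_simp

/-- Sublinear convergence of the dual objective along a run. -/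
lemma IsRun.dual_rate {μ L β c₁ c₂ : ℝ} {m B : ℕ} {G : ℕ → SimpleGraph (Fin n)}
    {h : ℕ → Fin n → Fin n → ℝ} {w x : ℕ → Stack n d}
    (hrun : IsRun f G h β L c₁ c₂ m w x)
    (H : ∀ i, ConjFacts (dom (f i)) (fun x => (f i x).toReal) μ (dual (f i)))
    (hμ : 0 < μ) (hL : L = 1 / μ) (hβ : β ∈ Set.Ioo 0 (1 / L)) (hc₁ : 0 < c₁) (hc₂ : 0 < c₂)
    (hconv : ∀ i, StrongConvexOn (dom (f i)) μ (fun x => (f i x).toReal))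
    (hint : (interior (⋂ i, dom (f i))).Nonempty) (hB : 0 < B)
    (hconn : ∀ k, (unionGraph G B k).Connected)
    (hsymm : ∀ k i j, (G k).Adj i j → h k i j = h k j i)
    (hpos : ∃ c > 0, ∀ k i j, (G k).Adj i j → c ≤ h k i j)
    (hsum : ∀ k i, ∑ j ∈ nbrs (G k) i, h k i j ≤ 1)
    (hmem : ∀ k, w k ∈ sublevel f (w 0))
    (hanti : Antitone fun k => dualObj f (w k)) :
    (∀ k : ℕ, dualObj f (w k) - dualValue f ≤
      tau G h B β L c₁ c₂ * radius f (w 0) ^ 2 * (dualObj f (w 0) - dualValue f) /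
        (tau G h B β L c₁ c₂ * radius f (w 0) ^ 2 +
          lapInf G B * ((k / B : ℕ) : ℝ) * (dualObj f (w 0) - dualValue f))) ∧
    ∃ C : ℝ, 0 ≤ C ∧ ∀ k : ℕ, 0 < k → dualObj f (w k) - dualValue f ≤ C * (1 / (k : ℝ)) := by
  obtain ⟨ws, hws, hval, hmin⟩ := exists_dual_minimizer H hμ hconv hint
  have hLpos : 0 < L := by rw [hL]; positivity
  -- With zero initial gap the right-hand side is `0`, also when its denominator vanishes. Otherwise
  -- `w 0` is not optimal, which forces `n ≥ 2` and `R₀ > 0`.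
  rcases (sub_nonneg.2 (hmin _ (hmem 0).2)).eq_or_lt with hzero | hgap
  · have hk : ∀ k, dualObj f (w k) - dualValue f ≤ 0 := fun k => by
      have := (hmem k).1
      linarith
    refine ⟨fun k => ?_, 0, le_rfl, fun k _ => by simpa using hk k⟩
    rw [← hzero]
    simpa using hk k
  have hne : ws ≠ w 0 := fun h0 => by rw [← h0, hval, sub_self] at hgap; exact hgap.false
  have hn : 2 ≤ n := by
    by_contra hlt
    refine hne ?_
    have hsub : Subsingleton (Fin n) := Fin.subsingleton_iff_le_one.2 (by omega)
    have heq : ∀ v ∈ dualFeasible n d, ∀ i, v i = 0 := fun v hv i => by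
      rw [← Fintype.sum_subsingleton (fun i => v i) i]
      exact hv
    ext1 i
    rw [heq ws hws i, heq _ (hmem 0).2 i]
  obtain ⟨c, hc, hge⟩ := hpos
  have hθ₁ := theta₁_pos hLpos hβ hc₁
  have hθ₂ := theta₂_pos hLpos hβ hc₂
  have hwpos : 0 < weightInf G h :=
    hc.trans_le (le_weightInf hge (exists_adj_of_connected_unionGraph (hconn 0) hn))
  have hstep := hrun.step_facts H hμ hL hβ.1 hwpos.le hθ₁.le hθ₂.le
    (fun k i j => weightInf_le hge) hsymm hsum
  have hbdd := (isCompact_sublevel H hμ hconv hint (w 0)).isBounded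
  have hwsmem : ws ∈ sublevel f (w 0) := ⟨hval ▸ hmin _ (hmem 0).2, hws⟩
  have hdist : ∀ v ∈ sublevel f (w 0), ‖v - ws‖ ≤ radius f (w 0) := fun v hv => by
    rw [← dist_eq_norm]
    exact Metric.dist_le_diam_of_mem hbdd hv hwsmem
  have hR : 0 < radius f (w 0) :=
    (norm_pos_iff.2 (sub_ne_zero.2 hne.symm)).trans_le (hdist _ (hmem 0))
  have htau : 0 < tau G h B β L c₁ c₂ := by
    unfold tau
    have : 0 < weightInf G h * theta₁ β L c₁ := mul_pos hwpos hθ₁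
    positivity
  have hlam := lapInf_pos hconn hn
  set T := tau G h B β L c₁ c₂ * radius f (w 0) ^ 2 with hT
  have hTpos : 0 < T := by positivity
  have hbound : ∀ k : ℕ, dualObj f (w k) - dualValue f ≤ T * (dualObj f (w 0) - dualValue f) /
      (T + lapInf G B * ((k / B : ℕ) : ℝ) * (dualObj f (w 0) - dualValue f)) := by
    intro k
    have hrate := rate_of_recursion (a := fun t => dualObj f (w (t * B)) - dualValue f)
      (fun t => sub_nonneg.2 (hmin _ (hmem _).2)) hlam.le hTpos (fun t => by
        have h1 := sq_dual_gap_le H hμ (by omega) (hmem (t * B)).2 hws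
          (hval ▸ hmin _ (hmem _).2) (hdist _ (hmem (t * B))) (hconn (t * B))
          (lapMin_pos (hconn (t * B)) hn).le
        have h2 := window_bound (G := G) (B := B) H hμ hL (mul_pos hwpos hθ₁) hθ₂
          (fun k => (hstep k).2.1) (fun k => (hstep k).2.2) t
        have h3 := mul_le_mul_of_nonneg_right (lapInf_le (G := G) (B := B) t)
          (sq_nonneg (dualObj f (w (t * B)) - dualValue f))
        rw [hval] at h1
        have h4 := mul_le_mul_of_nonneg_left h2 (sq_nonneg (radius f (w 0)))
        refine h3.trans (h1.trans (h4.trans (le_of_eq ?_)))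
        rw [Nat.succ_mul, hT, tau]
        ring) (k / B)
    simp only [zero_mul] at hrate
    refine le_trans ?_ hrate
    -- Between window starts, monotonicity of the dual values suffices.
    exact sub_le_sub_right (hanti (Nat.div_mul_le_self k B)) _
  refine ⟨hbound, _, ?_, fun k hk => (hbound k).trans (window_rate_le_inv hTpos hlam hgap hB hk)⟩
  have : 0 < min T (lapInf G B * (dualObj f (w 0) - dualValue f)) :=
    lt_min hTpos (mul_pos hlam hgap)
  positivity

lemma sqrt_le_of_le_inv {L a C : ℝ} {k : ℕ} (hL : 0 ≤ L) (hC : 0 ≤ C)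
    (ha : a ≤ C * (1 / (k : ℝ))) :
    Real.sqrt (2 * L * a) ≤ Real.sqrt (2 * L * C) * (1 / Real.sqrt (k : ℝ)) := by
  rw [mul_one_div, ← Real.sqrt_div (by positivity)]
  refine Real.sqrt_le_sqrt ?_
  calc 2 * L * a ≤ 2 * L * (C * (1 / (k : ℝ))) := by gcongr
    _ = _ := by ring

end Run

end FDGMAA

end

/-! ### The main theorem -/

theorem theorem1 {n d : ℕ}
    (f : Fin n → FDGMAA.Vec d → EReal) (hbot : ∀ i x, f i x ≠ ⊥)
    (μ : ℝ) (hμ : 0 < μ)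
    (hconv : ∀ i, StrongConvexOn (FDGMAA.dom (f i)) μ (fun x => (f i x).toReal))
    (hint : (interior (⋂ i, FDGMAA.dom (f i))).Nonempty)
    (G : ℕ → SimpleGraph (Fin n)) (B : ℕ) (hB : 0 < B)
    (hconn : ∀ k, (FDGMAA.unionGraph G B k).Connected)
    (h : ℕ → Fin n → Fin n → ℝ)
    (hsymm : ∀ k i j, (G k).Adj i j → h k i j = h k j i)
    (hpos : ∃ c > 0, ∀ k i j, (G k).Adj i j → c ≤ h k i j)
    (hsum : ∀ k i, ∑ j ∈ FDGMAA.nbrs (G k) i, h k i j ≤ 1)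
    (L : ℝ) (hL : L = 1 / μ) (β : ℝ) (hβ : β ∈ Set.Ioo 0 (1 / L))
    (c₁ c₂ : ℝ) (hc₁ : 0 < c₁) (hc₂ : 0 < c₂) (m : ℕ) (hm : 0 < m)
    (w x : ℕ → FDGMAA.Stack n d)
    (hrun : FDGMAA.IsRun f G h β L c₁ c₂ m w x) :
    -- the quantities in the bounds are genuine: `D` is finite, `D⋆` is attained, `S₀` is compact,
    -- `F⋆` and `F(x^k)` are finite
    (∀ i v, FDGMAA.conj (f i) v = (FDGMAA.dual (f i) v : EReal)) ∧
    IsLeast (FDGMAA.dualObj f '' FDGMAA.dualFeasible n d) (FDGMAA.dualValue f) ∧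
    IsCompact (FDGMAA.sublevel f (w 0)) ∧
    (FDGMAA.primalValue f = ((FDGMAA.primalValue f).toReal : EReal)) ∧
    (∀ k, FDGMAA.primalObj f (x k) = ((FDGMAA.primalObj f (x k)).toReal : EReal)) ∧
    -- dual error
    (∀ k : ℕ, FDGMAA.dualObj f (w k) - FDGMAA.dualValue f ≤
      FDGMAA.tau G h B β L c₁ c₂ * FDGMAA.radius f (w 0) ^ 2 *
          (FDGMAA.dualObj f (w 0) - FDGMAA.dualValue f) /
        (FDGMAA.tau G h B β L c₁ c₂ * FDGMAA.radius f (w 0) ^ 2 +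
          FDGMAA.lapInf G B * ((k / B : ℕ) : ℝ) *
            (FDGMAA.dualObj f (w 0) - FDGMAA.dualValue f))) ∧
    (fun k : ℕ => FDGMAA.dualObj f (w k) - FDGMAA.dualValue f)
      =O[Filter.atTop] (fun k : ℕ => 1 / (k : ℝ)) ∧
    -- there is exactly one primal solution, as soon as all the maxima that define the conjugates
    -- are attained (for instance when every `f i` is lower semicontinuous)
    ((∀ i v, ∃ y, FDGMAA.IsConjMaximizer (f i) v y) → ∃! xs, FDGMAA.IsPrimalSolution f xs) ∧
    -- distance to the primal solution
    (∀ xs, FDGMAA.IsPrimalSolution f xs →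
      (∀ k, ‖x k - xs‖ ≤
        Real.sqrt (2 * L * (FDGMAA.dualObj f (w k) - FDGMAA.dualValue f))) ∧
      (fun k : ℕ => ‖x k - xs‖) =O[Filter.atTop] (fun k : ℕ => 1 / Real.sqrt (k : ℝ))) ∧
    -- primal objective error
    (∀ k, |(FDGMAA.primalObj f (x k)).toReal - (FDGMAA.primalValue f).toReal| ≤
      (FDGMAA.radius f (w 0) + ‖w 0‖) *
        Real.sqrt (2 * L * (FDGMAA.dualObj f (w k) - FDGMAA.dualValue f))) ∧
    (fun k : ℕ => (FDGMAA.primalObj f (x k)).toReal - (FDGMAA.primalValue f).toReal)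
      =O[Filter.atTop] (fun k : ℕ => 1 / Real.sqrt (k : ℝ)) := by
  have hn : 0 < n := by
    obtain ⟨i⟩ := (hconn 0).nonempty
    exact i.pos
  have hLpos : 0 < L := by rw [hL]; positivity
  have hne : ∀ i, (FDGMAA.dom (f i)).Nonempty := fun i =>
    (hint.mono interior_subset).mono (Set.iInter_subset _ i)
  have hLUB : ∀ i v, IsLUB ((fun y => inner ℝ v y - (f i y).toReal) '' FDGMAA.dom (f i))
      (FDGMAA.dual (f i) v) := fun i v =>
    FDGMAA.isLUB_dual (hbot i) hμ (hconv i) (hne i) (hrun.primal 0 i) v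
  have H : ∀ i, FDGMAA.ConjFacts (FDGMAA.dom (f i)) (fun x => (f i x).toReal) μ
      (FDGMAA.dual (f i)) := fun i => FDGMAA.conjFacts hμ (hconv i) (hne i) (hLUB i)
  obtain ⟨ws, hws, hval, hmin⟩ := FDGMAA.exists_dual_minimizer H hμ hconv hint
  have hxd : ∀ k i, x k i ∈ FDGMAA.dom (f i) := fun k i =>
    (hrun.primal k i).mem_dom (hbot i) (hne i)
  have hmax : ∀ k i, FDGMAA.dual (f i) (w k i) = inner ℝ (w k i) (x k i) - (f i (x k i)).toReal :=
    fun k i => (hrun.primal k i).dual_eq (hbot i) (hne i) (hLUB i _)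
  have hθ₁ := FDGMAA.theta₁_pos hLpos hβ hc₁
  have hθ₂ := FDGMAA.theta₂_pos hLpos hβ hc₂
  -- Any positive lower bound on the weights gives monotonicity and feasibility; the exact infimum
  -- enters in `IsRun.dual_rate`.
  obtain ⟨c, hc, hge⟩ := id hpos
  have hstep := hrun.step_facts H hμ hL hβ.1 hc.le hθ₁.le hθ₂.le hge hsymm hsum
  have hanti : Antitone fun k => FDGMAA.dualObj f (w k) := antitone_nat_of_succ_le fun k => by
    have h1 : 0 ≤ FDGMAA.theta₂ β L c₂ * ∑ i, ‖w (k + 1) i - w k i‖ ^ 2 := by positivity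
    linarith [(hstep k).2.2]
  have hfeas : ∀ k, w k ∈ FDGMAA.dualFeasible n d := fun k => by
    induction k with
    | zero => exact hrun.init
    | succ k ih => exact (hstep k).1.trans ih
  have hmem : ∀ k, w k ∈ FDGMAA.sublevel f (w 0) := fun k => ⟨hanti (Nat.zero_le k), hfeas k⟩
  obtain ⟨hrate, C, hC, hrateC⟩ := hrun.dual_rate H hμ hL hβ hc₁ hc₂ hconv hint hB hconn hsymm
    hpos hsum hmem hanti
  have hdist : ∀ xs, FDGMAA.IsPrimalSolution f xs → ∀ k, ‖x k - xs‖ ≤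
      Real.sqrt (2 * L * (FDGMAA.dualObj f (w k) - FDGMAA.dualValue f)) := fun xs hxs k => by
    rw [hL]
    exact FDGMAA.sq_dist_gradient_le H hμ (hfeas k) hws hval
      (fun i => (H i).gradient_eq_of_max hμ (hxd k i) (hmax k i))
      (fun i => FDGMAA.primalSolution_eq H hbot hμ hn hconv hint hws hval hxs i) hxs.1
  have hobj : ∀ k, |(FDGMAA.primalObj f (x k)).toReal - (FDGMAA.primalValue f).toReal| ≤
      (FDGMAA.radius f (w 0) + ‖w 0‖) *
        Real.sqrt (2 * L * (FDGMAA.dualObj f (w k) - FDGMAA.dualValue f)) := fun k => by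
    rw [hL]
    exact FDGMAA.abs_primalObj_sub_le H hbot hμ hn hconv hint (hmem k) (hfeas 0) (hxd k) (hmax k)
  refine ⟨fun i v => FDGMAA.conj_eq_coe_of_isLUB (hbot i) (hne i) v (hLUB i v), ?_,
    FDGMAA.isCompact_sublevel H hμ hconv hint _, ?_, fun k => ?_, hrate, ?_,
    FDGMAA.existsUnique_primalSolution H hbot hμ hn hconv hint hLUB,
    fun xs hxs => ⟨hdist xs hxs, ?_⟩, hobj, ?_⟩
  · refine ⟨⟨ws, hws, hval⟩, ?_⟩
    rintro _ ⟨v, hv, rfl⟩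
    exact hmin v hv
  · rw [FDGMAA.strong_duality H hbot hμ hn hconv hint, EReal.toReal_coe]
  · rw [FDGMAA.primalObj_eq_coe hbot (hxd k), EReal.toReal_coe]
  · refine Asymptotics.IsBigO.of_bound C ?_
    filter_upwards [Filter.eventually_gt_atTop 0] with k hk
    rw [Real.norm_of_nonneg (sub_nonneg.2 (hmin _ (hfeas k))), Real.norm_of_nonneg (by positivity)]
    exact hrateC k hk
  · refine Asymptotics.IsBigO.of_bound (Real.sqrt (2 * L * C)) ?_
    filter_upwards [Filter.eventually_gt_atTop 0] with k hk
    rw [norm_norm, Real.norm_of_nonneg (by positivity)]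
    exact (hdist xs hxs k).trans (FDGMAA.sqrt_le_of_le_inv hLpos.le hC (hrateC k hk))
  · refine Asymptotics.IsBigO.of_bound
      ((FDGMAA.radius f (w 0) + ‖w 0‖) * Real.sqrt (2 * L * C)) ?_
    filter_upwards [Filter.eventually_gt_atTop 0] with k hk
    rw [Real.norm_eq_abs, Real.norm_of_nonneg (by positivity), mul_assoc]
    refine (hobj k).trans (mul_le_mul_of_nonneg_left
      (FDGMAA.sqrt_le_of_le_inv hLpos.le hC (hrateC k hk)) ?_)
    exact add_nonneg Metric.diam_nonneg (norm_nonneg _)
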